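/- Write $\mathbb{C}_{1/2}=\{s\in\mathbb{C}:\operatorname{Re}s>1/2\}$ and let $p\in[1,\infty)$. The Hardy space $H^p(\mathbb{C}_{1/2})$ consists of the holomorphic functions $f$ on $\mathbb{C}_{1/2}$ with $$\|f\|_{H^p(\mathbb{C}_{1/2})}=\sup_{\sigma>1/2}\Big(\int_{\mathbb{R}}|f(\sigma+\mathrm{i}t)|^p\,\mathrm{d}t\Big)^{1/p}<\infty .$$ The Dirichlet–Hardy space $\mathscr{H}^p$ is the completion of the Dirichlet polynomials $P(s)=\sum_{n\le N}a_nn^{-s}$, $a_n\in\mathbb{C}$, in the norm $$\|P\|_{\mathscr{H}^p}=\lim_{T\to\infty}\Big(\frac1{2T}\int_{-T}^{T}|P(\mathrm{i}t)|^p\,\mathrm{d}t\Big)^{1/p},$$ its elements being regarded as functions on $\mathbb{C}_{1/2}$: a Cauchy sequence $(P_k)$ of Dirichlet polynomials in this norm represents its pointwise limit $F=\lim_kP_k$ on $\mathbb{C}_{1/2}$, and $\|F\|_{\mathscr{H}^p}=\lim_k\|P_k\|_{\mathscr{H}^p}$. For $X=H^p(\mathbb{C}_{1/2})$ or $X=\mathscr{H}^p$,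 a positive Borel measure $\mu$ on $\mathbb{C}_{1/2}$ is called a Carleson measure for $X$ if there is a constant $C>0$ such that $$\int_{\mathbb{C}_{1/2}}|f(s)|^p\,\mathrm{d}\mu(s)\le C\,\|f\|_X^p\qquad\text{for all }f\in X .$$ Theorem. Let $p\in[1,\infty)$ and let $\mu$ be a positive Borel measure on $\mathbb{C}_{1/2}$. If $\mu$ is a Carleson measure for $\mathscr{H}^p$, then $\mu$ is a Carleson measure for $H^p(\mathbb{C}_{1/2})$. -/

import Mathlib

open MeasureTheory Filter Topology
open scoped ENNReal

/-- The open half-plane `ℂ_{1/2} = {s : Re s > 1/2}`. It carries the Borel σ-algebra. -/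
def halfPlane : Set ℂ := {s : ℂ | 1 / 2 < s.re}

/-! ### The classical Hardy spaces of the half-plane -/

/-- `‖f‖_{H^p(ℂ_{1/2})} = sup_{σ > 1/2} (∫_ℝ |f(σ + i t)|^p dt)^{1/p}`, a value in `[0, ∞]`. -/
noncomputable def hardyNorm (p : ℝ) (f : ℂ → ℂ) : ℝ≥0∞ :=
  ⨆ (σ : ℝ) (_ : 1 / 2 < σ), (∫⁻ t : ℝ, ‖f (σ + Complex.I * t)‖ₑ ^ p) ^ (1 / p)

/-- `f ∈ H^p(ℂ_{1/2})`: `f` is holomorphic on the half-plane and has finite norm. The values of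
`f` off the half-plane play no role. -/
def MemHardy (p : ℝ) (f : ℂ → ℂ) : Prop :=
  DifferentiableOn ℂ f halfPlane ∧ hardyNorm p f < ∞

/-! ### Dirichlet polynomials -/

/-- The finite sequence `(a_n)_{n ≥ 1}` stands for the Dirichlet polynomial `∑ a_n n^{-s}`. -/
abbrev DirichletPoly : Type := ℕ+ →₀ ℂ

/-- The value `∑ a_n n^{-s}` of a Dirichlet polynomial at `s`. -/
noncomputable def DirichletPoly.eval (P : DirichletPoly) (s : ℂ) : ℂ :=
  P.sum fun n a => a * ((n : ℕ) : ℂ) ^ (-s)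

/-- The mean `((1 / 2T) ∫_{-T}^{T} |P(i t)|^p dt)^{1/p}`. -/
noncomputable def DirichletPoly.mean (p : ℝ) (P : DirichletPoly) (T : ℝ) : ℝ :=
  (1 / (2 * T) * ∫ t in (-T)..T, ‖P.eval (Complex.I * t)‖ ^ p) ^ (1 / p)

/-- `‖P‖_{𝓗^p} = lim_{T → ∞} ((1 / 2T) ∫_{-T}^{T} |P(i t)|^p dt)^{1/p}`. The limit always exists,
see `DirichletPoly.tendsto_mean`. -/
noncomputable def DirichletPoly.norm (p : ℝ) (P : DirichletPoly) : ℝ :=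
  limUnder atTop (P.mean p)

/-! The limit in the definition of the norm exists: `|P(i t)|^p` is a uniform limit of
trigonometric polynomials. -/

/-- Finite linear combinations of the functions `t ↦ e^{i l t}` with `l` real. -/
noncomputable def trigPoly : Subalgebra ℂ (ℝ → ℂ) :=
  Algebra.adjoin ℂ (Set.range fun (l : ℝ) (t : ℝ) => Complex.exp (Complex.I * l * t))

theorem trigPoly_exp_mem (l : ℝ) :
    (fun t : ℝ => Complex.exp (Complex.I * l * t)) ∈ trigPoly :=
  Algebra.subset_adjoin ⟨l, rfl⟩

theorem trigPoly_mean_exp (l : ℝ) :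
    ∃ L : ℂ, Tendsto (fun T : ℝ => (1 / (2 * T) : ℂ) *
      ∫ t in (-T)..T, Complex.exp (Complex.I * l * t)) atTop (𝓝 L) := by
  by_cases hl : l = 0
  · refine ⟨1, tendsto_const_nhds.congr' ?_⟩
    filter_upwards [eventually_gt_atTop 0] with T hT
    have : (T : ℂ) ≠ 0 := by exact_mod_cast hT.ne'
    simp [hl]
    field_simp
    ring
  · refine ⟨0, squeeze_zero_norm' (a := fun T => (1 / |l|) * T⁻¹) ?_ ?_⟩
    · filter_upwards [eventually_gt_atTop 0] with T hT
      have hc : Complex.I * l ≠ 0 := by simp [hl]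
      rw [integral_exp_mul_complex hc]
      have h1 : ∀ x : ℝ, ‖Complex.exp (Complex.I * l * x)‖ = 1 := by
        intro x
        have : Complex.I * l * x = ((l * x : ℝ) : ℂ) * Complex.I := by push_cast; ring
        rw [this, Complex.norm_exp_ofReal_mul_I]
      have h2 : ‖Complex.exp (Complex.I * l * T) - Complex.exp (Complex.I * l * (-T : ℝ))‖ ≤ 2 := by
        refine (norm_sub_le _ _).trans ?_
        rw [h1, h1]
        norm_num
      rw [norm_mul, norm_div, norm_div, norm_mul, norm_mul]
      simp only [norm_one, Complex.norm_I, one_mul, Complex.norm_real, Real.norm_eq_abs,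
        Complex.norm_ofNat, abs_of_pos hT]
      have hl' : 0 < |l| := abs_pos.mpr hl
      calc 1 / (2 * T) * (‖Complex.exp (Complex.I * l * T)
              - Complex.exp (Complex.I * l * (-T : ℝ))‖ / |l|)
          ≤ 1 / (2 * T) * (2 / |l|) := by gcongr
        _ = 1 / |l| * T⁻¹ := by field_simp
    · simpa using tendsto_inv_atTop_zero.const_mul (1 / |l|)

theorem trigPoly_continuous_and_mean {f : ℝ → ℂ} (hf : f ∈ trigPoly) :
    Continuous f ∧ ∃ L : ℂ, Tendsto (fun T : ℝ => (1 / (2 * T) : ℂ) *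
      ∫ t in (-T)..T, f t) atTop (𝓝 L) := by
  have hf' : f ∈ Submodule.span ℂ
      (Set.range fun (l : ℝ) (t : ℝ) => Complex.exp (Complex.I * l * t)) := by
    let S : Submonoid (ℝ → ℂ) :=
      { carrier := Set.range fun (l : ℝ) (t : ℝ) => Complex.exp (Complex.I * l * t)
        one_mem' := ⟨0, by ext t; simp⟩
        mul_mem' := by
          rintro _ _ ⟨a, rfl⟩ ⟨b, rfl⟩
          refine ⟨a + b, ?_⟩
          ext t
          simp only [Pi.mul_apply, ← Complex.exp_add]
          push_cast
          ring_nf }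
    have h : f ∈ Subalgebra.toSubmodule trigPoly := hf
    rw [trigPoly, Algebra.adjoin_eq_span] at h
    have hS : Submonoid.closure
        (Set.range fun (l : ℝ) (t : ℝ) => Complex.exp (Complex.I * l * t)) = S :=
      Submonoid.closure_eq S
    rw [hS] at h
    exact h
  induction hf' using Submodule.span_induction with
  | mem x hx =>
    obtain ⟨l, rfl⟩ := hx
    exact ⟨by fun_prop, trigPoly_mean_exp l⟩
  | zero => exact ⟨continuous_const, 0, by simp⟩
  | add x y hx hy ihx ihy =>
    have mx : x ∈ trigPoly := Algebra.span_le_adjoin _ _ hx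
    have my : y ∈ trigPoly := Algebra.span_le_adjoin _ _ hy
    obtain ⟨cx, Lx, hLx⟩ := ihx mx
    obtain ⟨cy, Ly, hLy⟩ := ihy my
    refine ⟨cx.add cy, Lx + Ly, (hLx.add hLy).congr fun T => ?_⟩
    simp only [Pi.add_apply]
    rw [intervalIntegral.integral_add (cx.intervalIntegrable _ _) (cy.intervalIntegrable _ _),
      mul_add]
  | smul a x hx ihx =>
    have mx : x ∈ trigPoly := Algebra.span_le_adjoin _ _ hx
    obtain ⟨cx, Lx, hLx⟩ := ihx mx
    refine ⟨cx.const_smul a, a * Lx, (hLx.const_mul a).congr fun T => ?_⟩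
    simp only [Pi.smul_apply, smul_eq_mul]
    rw [intervalIntegral.integral_const_mul]
    ring

theorem exists_mean_of_approx {g : ℝ → ℂ} (hg : Continuous g)
    (h : ∀ ε > 0, ∃ f ∈ trigPoly, ∀ t, ‖g t - f t‖ ≤ ε) :
    ∃ L : ℂ, Tendsto (fun T : ℝ => (1 / (2 * T) : ℂ) * ∫ t in (-T)..T, g t) atTop (𝓝 L) := by
  refine cauchy_map_iff_exists_tendsto.mp ?_
  rw [Metric.cauchy_iff]
  refine ⟨inferInstance, fun ε hε => ?_⟩
  obtain ⟨f, hf, hfg⟩ := h (ε / 8) (by positivity)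
  obtain ⟨cf, L, hL⟩ := trigPoly_continuous_and_mean hf
  have hev := (Metric.tendsto_nhds.mp hL (ε / 8) (by positivity)).and (eventually_gt_atTop 0)
  refine ⟨_, image_mem_map hev, ?_⟩
  have key : ∀ T : ℝ, (dist ((1 / (2 * T) : ℂ) * ∫ t in (-T)..T, f t) L < ε / 8 ∧ 0 < T) →
      dist ((1 / (2 * T) : ℂ) * ∫ t in (-T)..T, g t) L < ε / 2 := by
    rintro T ⟨h1, hT⟩
    have h2 : dist ((1 / (2 * T) : ℂ) * ∫ t in (-T)..T, g t)
        ((1 / (2 * T) : ℂ) * ∫ t in (-T)..T, f t) ≤ ε / 8 := by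
      rw [dist_eq_norm, ← mul_sub, ← intervalIntegral.integral_sub
        (hg.intervalIntegrable _ _) (cf.intervalIntegrable _ _), norm_mul]
      have h3 := intervalIntegral.norm_integral_le_of_norm_le_const (a := -T) (b := T)
        (f := fun t => g t - f t) (C := ε / 8) (fun t _ => hfg t)
      have h4 : ‖(1 / (2 * T) : ℂ)‖ = 1 / (2 * T) := by
        simp [abs_of_pos hT]
      rw [h4]
      calc _ ≤ 1 / (2 * T) * (ε / 8 * |T - -T|) := by gcongr
        _ = ε / 8 := by
          rw [abs_of_pos (by linarith)]
          field_simp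
          ring
    linarith [dist_triangle ((1 / (2 * T) : ℂ) * ∫ t in (-T)..T, g t)
      ((1 / (2 * T) : ℂ) * ∫ t in (-T)..T, f t) L]
  rintro _ ⟨T, hT, rfl⟩ _ ⟨U, hU, rfl⟩
  have := dist_triangle_right ((1 / (2 * T) : ℂ) * ∫ t in (-T)..T, g t)
    ((1 / (2 * U) : ℂ) * ∫ t in (-U)..U, g t) L
  linarith [key T hT, key U hU]

theorem natCast_cpow_eq_exp (n : ℕ+) (t : ℝ) (c : ℝ) :
    ((n : ℕ) : ℂ) ^ (c * (Complex.I * t)) =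
      Complex.exp (Complex.I * ((c * Real.log n : ℝ) : ℂ) * t) := by
  rw [Complex.cpow_def_of_ne_zero (by exact_mod_cast n.pos.ne'), ← Complex.natCast_log]
  push_cast
  ring_nf

theorem DirichletPoly.eval_mem_trigPoly (P : DirichletPoly) :
    (fun t : ℝ => P.eval (Complex.I * t)) ∈ trigPoly ∧
      (fun t : ℝ => (starRingEnd ℂ) (P.eval (Complex.I * t))) ∈ trigPoly := by
  have h0 : ∀ (n : ℕ+) (t : ℝ), ((n : ℕ) : ℂ) ^ (-(Complex.I * t)) =
      Complex.exp (Complex.I * ((-1 * Real.log n : ℝ) : ℂ) * t) := by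
    intro n t
    rw [← natCast_cpow_eq_exp n t (-1)]
    push_cast
    ring_nf
  constructor
  · have : (fun t : ℝ => P.eval (Complex.I * t)) = ∑ n ∈ P.support, P n •
        fun t : ℝ => Complex.exp (Complex.I * ((-1 * Real.log n : ℝ) : ℂ) * t) := by
      ext t
      simp only [DirichletPoly.eval, Finsupp.sum, Finset.sum_apply, Pi.smul_apply, smul_eq_mul, h0]
    rw [this]
    exact sum_mem fun n _ => Subalgebra.smul_mem _ (trigPoly_exp_mem _) _
  · have : (fun t : ℝ => (starRingEnd ℂ) (P.eval (Complex.I * t))) =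
        ∑ n ∈ P.support, (starRingEnd ℂ) (P n) •
        fun t : ℝ => Complex.exp (Complex.I * ((Real.log n : ℝ) : ℂ) * t) := by
      ext t
      simp only [DirichletPoly.eval, Finsupp.sum, Finset.sum_apply, Pi.smul_apply, smul_eq_mul, h0,
        map_sum, map_mul, ← Complex.exp_conj, Complex.conj_I, Complex.conj_ofReal]
      refine Finset.sum_congr rfl fun n _ => ?_
      congr 2
      push_cast
      ring
    rw [this]
    exact sum_mem fun n _ => Subalgebra.smul_mem _ (trigPoly_exp_mem _) _

theorem DirichletPoly.norm_eval_le (P : DirichletPoly) (t : ℝ) :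
    ‖P.eval (Complex.I * t)‖ ≤ ∑ n ∈ P.support, ‖P n‖ := by
  refine (norm_sum_le _ _).trans (Finset.sum_le_sum fun n _ => ?_)
  rw [norm_mul, Complex.norm_natCast_cpow_of_pos n.pos]
  simp

theorem DirichletPoly.exists_tendsto_mean {p : ℝ} (hp : 0 < p) (P : DirichletPoly) :
    ∃ L, 0 ≤ L ∧ Tendsto (P.mean p) atTop (𝓝 L) := by
  have cP : Continuous fun t : ℝ => P.eval (Complex.I * t) :=
    (trigPoly_continuous_and_mean P.eval_mem_trigPoly.1).1
  have cr : Continuous fun t : ℝ => ‖P.eval (Complex.I * t)‖ ^ p :=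
    cP.norm.rpow_const fun _ => Or.inr hp.le
  obtain ⟨L, hL⟩ := exists_mean_of_approx (g := fun t => ((‖P.eval (Complex.I * t)‖ ^ p : ℝ) : ℂ))
    (Complex.continuous_ofReal.comp cr) (by
      intro ε hε
      obtain ⟨q, hq⟩ := exists_polynomial_near_of_continuousOn 0
        ((∑ n ∈ P.support, ‖P n‖) ^ 2) (fun x => x ^ (p / 2))
        (Continuous.continuousOn (Real.continuous_rpow_const (by positivity))) ε hε
      let Q : ℝ → ℂ := (fun t : ℝ => P.eval (Complex.I * t)) *
        fun t : ℝ => (starRingEnd ℂ) (P.eval (Complex.I * t))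
      have hQ : Q ∈ trigPoly := mul_mem P.eval_mem_trigPoly.1 P.eval_mem_trigPoly.2
      refine ⟨Polynomial.aeval Q (q.map (algebraMap ℝ ℂ)), ?_, fun t => ?_⟩
      · have h := (Polynomial.aeval (⟨Q, hQ⟩ : trigPoly) (q.map (algebraMap ℝ ℂ))).2
        rwa [← Subalgebra.aeval_coe] at h
      · have hQt : Q t = ((‖P.eval (Complex.I * t)‖ ^ 2 : ℝ) : ℂ) := by
          simp [Q, Complex.mul_conj']
        have h1 : (Polynomial.aeval Q (q.map (algebraMap ℝ ℂ))) t =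
            ((q.eval (‖P.eval (Complex.I * t)‖ ^ 2) : ℝ) : ℂ) := by
          have := Polynomial.aeval_algHom_apply (Pi.evalAlgHom ℂ (fun _ : ℝ => ℂ) t) Q
            (q.map (algebraMap ℝ ℂ))
          simp only [Pi.evalAlgHom_apply] at this
          rw [← this, hQt, Polynomial.aeval_map_algebraMap]
          exact Polynomial.aeval_algebraMap_apply_eq_algebraMap_eval _ _
        rw [h1, ← Complex.ofReal_sub, Complex.norm_real, Real.norm_eq_abs, abs_sub_comm]
        have h2 := hq (‖P.eval (Complex.I * t)‖ ^ 2)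
          ⟨by positivity, by gcongr; exact P.norm_eval_le t⟩
        have h3 : (‖P.eval (Complex.I * t)‖ ^ 2) ^ (p / 2) = ‖P.eval (Complex.I * t)‖ ^ p := by
          rw [← Real.rpow_natCast, ← Real.rpow_mul (norm_nonneg _)]
          congr 1
          push_cast
          ring
        rw [h3] at h2
        exact h2.le)
  have hre : Tendsto (fun T : ℝ => 1 / (2 * T) * ∫ t in (-T)..T, ‖P.eval (Complex.I * t)‖ ^ p)
      atTop (𝓝 L.re) := by
    refine ((Complex.continuous_re.tendsto L).comp hL).congr fun T => ?_
    simp only [Function.comp_apply, intervalIntegral.integral_ofReal]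
    norm_cast
  have h0 : 0 ≤ L.re := by
    refine ge_of_tendsto hre ?_
    filter_upwards [eventually_gt_atTop 0] with T hT
    have : 0 ≤ ∫ t in (-T)..T, ‖P.eval (Complex.I * t)‖ ^ p :=
      intervalIntegral.integral_nonneg (by linarith) fun t _ => by positivity
    positivity
  exact ⟨L.re ^ (1 / p), by positivity, hre.rpow_const (Or.inr (by positivity))⟩

theorem DirichletPoly.tendsto_mean {p : ℝ} (hp : 0 < p) (P : DirichletPoly) :
    Tendsto (P.mean p) atTop (𝓝 (P.norm p)) := by
  obtain ⟨L, _, hL⟩ := P.exists_tendsto_mean hp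
  exact tendsto_nhds_limUnder ⟨L, hL⟩

theorem DirichletPoly.norm_nonneg {p : ℝ} (hp : 0 < p) (P : DirichletPoly) : 0 ≤ P.norm p := by
  obtain ⟨L, h0, hL⟩ := P.exists_tendsto_mean hp
  rw [DirichletPoly.norm, hL.limUnder_eq]
  exact h0

/-! ### The Dirichlet–Hardy spaces

An element of the completion of the Dirichlet polynomials is given by a Cauchy sequence of them;
as point evaluations at `s ∈ ℂ_{1/2}` are bounded, it is identified with the pointwise limit of
that sequence on `ℂ_{1/2}`. -/

/-- `D` is a Cauchy sequence of Dirichlet polynomials in the norm of `𝓗^p`, and it converges to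
`F` at each point of the half-plane. -/
def DirichletPoly.Represents (p : ℝ) (D : ℕ → DirichletPoly) (F : ℂ → ℂ) : Prop :=
  (∀ ε > 0, ∃ K : ℕ, ∀ m ≥ K, ∀ n ≥ K, (D m - D n).norm p < ε) ∧
    ∀ s ∈ halfPlane, Tendsto (fun k => (D k).eval s) atTop (𝓝 (F s))

/-- `F ∈ 𝓗^p`, as a function on the half-plane. -/
def MemDirichletHardy (p : ℝ) (F : ℂ → ℂ) : Prop :=
  ∃ D : ℕ → DirichletPoly, DirichletPoly.Represents p D F

/-- `‖F‖_{𝓗^p} = lim_k ‖D_k‖_{𝓗^p}` for a sequence `D` representing `F ∈ 𝓗^p`. All such sequences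
are equivalent, so that the infimum is over a one-point set. -/
noncomputable def dirichletHardyNorm (p : ℝ) (F : ℂ → ℂ) : ℝ :=
  sInf {N : ℝ | ∃ D : ℕ → DirichletPoly, DirichletPoly.Represents p D F ∧
    Tendsto (fun k => (D k).norm p) atTop (𝓝 N)}

/-! ### Carleson measures -/

/-- `μ` is a Carleson measure for `H^p(ℂ_{1/2})`. -/
def IsCarlesonHardy (p : ℝ) (μ : Measure halfPlane) : Prop :=
  ∃ C : ℝ, 0 < C ∧ ∀ f : ℂ → ℂ, MemHardy p f →
    ∫⁻ s : halfPlane, ‖f s‖ₑ ^ p ∂μ ≤ ENNReal.ofReal C * hardyNorm p f ^ p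

/-- `μ` is a Carleson measure for `𝓗^p`. -/
def IsCarlesonDirichletHardy (p : ℝ) (μ : Measure halfPlane) : Prop :=
  ∃ C : ℝ, 0 < C ∧ ∀ F : ℂ → ℂ, MemDirichletHardy p F →
    ∫⁻ s : halfPlane, ‖F s‖ₑ ^ p ∂μ ≤ ENNReal.ofReal (C * dirichletHardyNorm p F ^ p)

/-!
A measure `μ` is tested, as a Carleson measure for `𝓗^p`, on approximations of the functions
`s ↦ ζ(s + a) ^ (2 / p)`, and the outcome is the classical box condition `μ(Q) ≤ A · side(Q)`, which
implies the embedding of `H^p` by Carleson's theorem.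

*Necessity of the box condition.* For `a = 1/2 + δ - i t` the finite Euler products
`G_N(s) = ∏_{q < N} (1 - q^{-(s + a)})⁻¹` have no zeros and are absolutely convergent Dirichlet
series on `Re s ≥ 0`. Hence the powers `G_N ^ (2 / p)` are uniform limits of Dirichlet polynomials
there (`isUniformDirichletLimit_one_add_cpow`), and as `|G_N ^ (2 / p)| ^ p = |G_N| ^ 2`, the
`p`-th power of the `𝓗^p`-norm is given by Parseval's identity (`tendsto_mean_norm_sq_sum_exp`),
with the bound `ζ(1 + 2 δ) ≲ 1 / δ`. On the box of side `δ` at the ordinate `t`, `G_N(s)` tends to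
`ζ(s + a)`, which has size at least `1 / (6 δ)` by the simple pole of `ζ` at `1`. By Fatou's lemma,
`δ⁻² μ(Q) ≲ δ⁻¹` for small `δ` (`exists_measure_carlesonBox_le`); large boxes are no obstacle, since
testing with the constant `1` shows that `μ` is finite.

*Sufficiency of the box condition* (`isCarlesonHardy_of_carlesonBox`). For `f ∈ H^p` the function
`|f| ^ (p / 2)` is dominated by the Poisson integral of its values on a vertical line, which are in
`L²` (`enorm_rpow_le_poissonIntegral`; the subharmonicity comes from Jensen's formula). The Poisson
integral maps `L¹(ℝ)` to weak `L¹(μ)` by Vitali's covering lemma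
(`mul_measure_lt_poissonIntegral_le`) and constants to bounded functions, and so `L²(ℝ)` to `L²(μ)`
by interpolation (`lintegral_sq_le_of_le_poissonIntegral`). The exponent `p / 2` serves to make this
work for `p = 1` too, where the weak type estimate alone would not suffice.
-/

/-! ### Subharmonicity of powers of the modulus -/

/-- The sub-mean value property of `‖f‖ ^ q` for any `q > 0`: Jensen's formula gives it for
`log ‖f‖`, and `exp` is convex. -/
theorem AnalyticOnNhd.norm_rpow_le_circleAverage {f : ℂ → ℂ} {c : ℂ} {R q : ℝ} (hR : 0 < R)
    (hq : 0 < q) (hf : AnalyticOnNhd ℂ f (Metric.closedBall c R)) :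
    ‖f c‖ ^ q ≤ Real.circleAverage (fun z => ‖f z‖ ^ q) c R := by
  by_cases h0 : f c = 0
  · rw [h0, norm_zero, Real.zero_rpow hq.ne']
    exact Real.circleAverage_nonneg_of_nonneg fun x _ => by positivity
  have hR' : |R| = R := abs_of_pos hR
  have hfR : AnalyticOnNhd ℂ f (Metric.closedBall c |R|) := by rwa [hR']
  have hc0 : 0 < ‖f c‖ := norm_pos_iff.mpr h0
  have hlog : Real.log ‖f c‖ ≤ Real.circleAverage (fun z => Real.log ‖f z‖) c R := by
    rw [hfR.circleAverage_log_norm hR.ne' h0]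
    refine le_add_of_nonneg_left (finsum_nonneg fun u => ?_)
    by_cases hu : u ∈ Metric.closedBall c |R|
    · refine mul_nonneg (by exact_mod_cast MeromorphicOn.AnalyticOnNhd.divisor_nonneg hfR u) ?_
      by_cases huc : c = u
      · simp [huc]
      · refine Real.log_nonneg ?_
        have : 0 < ‖c - u‖ := norm_pos_iff.mpr (sub_ne_zero.mpr huc)
        rw [← div_eq_mul_inv, one_le_div this, ← dist_eq_norm, dist_comm]
        simpa [hR'] using hu
    · simp [hu]
  have hcont : ContinuousOn f (Metric.sphere c |R|) :=
    hfR.continuousOn.mono Metric.sphere_subset_closedBall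
  have hi1 : CircleIntegrable (fun z => Real.log ‖f z‖) c R :=
    MeromorphicOn.circleIntegrable_log_norm
      (hfR.mono Metric.sphere_subset_closedBall).meromorphicOn
  have hi2 : CircleIntegrable (fun z => ‖f z‖ ^ q) c R := by
    refine ContinuousOn.circleIntegrable' ?_
    exact hcont.norm.rpow_const fun _ _ => Or.inr hq.le
  -- `x ^ q ≥ ‖f c‖ ^ q * (1 + q * (log x - log ‖f c‖))` for `x > 0`, and zeros are negligible
  have hne : ∀ᶠ z in codiscreteWithin (Metric.sphere c |R|), f z ≠ 0 := by
    have h1 : f ⁻¹' {0}ᶜ ∈ codiscreteWithin (Metric.closedBall c |R|) :=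
      hfR.preimage_zero_mem_codiscreteWithin h0 (by simp) (by
        exact (convex_closedBall c |R|).isConnected (by simp))
    exact Filter.codiscreteWithin_mono Metric.sphere_subset_closedBall h1
  have hae : ∀ᵐ θ ∂(volume.restrict (Set.uIoc 0 (2 * Real.pi))), f (circleMap c R θ) ≠ 0 := by
    apply ae_restrict_le_codiscreteWithin measurableSet_uIoc
    exact Filter.codiscreteWithin_mono (by tauto) (circleMap_preimage_codiscrete hR.ne' hne)
  set A := ‖f c‖ ^ q
  have hA : 0 < A := by positivity
  have hpt : ∀ x : ℝ, 0 < x → A * (1 + q * (Real.log x - Real.log ‖f c‖)) ≤ x ^ q := by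
    intro x hx
    have h1 := Real.add_one_le_exp (q * (Real.log x - Real.log ‖f c‖))
    have h2 : x ^ q = A * Real.exp (q * (Real.log x - Real.log ‖f c‖)) := by
      simp only [A]
      rw [Real.rpow_def_of_pos hx, Real.rpow_def_of_pos hc0, ← Real.exp_add]
      ring_nf
    rw [h2]
    gcongr
    linarith
  have hmono : (∫ θ in (0 : ℝ)..2 * Real.pi,
        (A * (1 - q * Real.log ‖f c‖) + A * q * Real.log ‖f (circleMap c R θ)‖)) ≤
      ∫ θ in (0 : ℝ)..2 * Real.pi, ‖f (circleMap c R θ)‖ ^ q := by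
    refine intervalIntegral.integral_mono_ae_restrict Real.two_pi_pos.le
      ((intervalIntegrable_const).add (hi1.const_mul _)) hi2 ?_
    rw [← Measure.restrict_congr_set Ioc_ae_eq_Icc, ← Set.uIoc_of_le Real.two_pi_pos.le]
    filter_upwards [hae] with θ hθ
    have := hpt _ (norm_pos_iff.mpr hθ)
    linarith
  rw [intervalIntegral.integral_add intervalIntegrable_const (hi1.const_mul _),
    intervalIntegral.integral_const, intervalIntegral.integral_const_mul] at hmono
  have hpi := Real.two_pi_pos
  rw [Real.circleAverage, smul_eq_mul] at hlog ⊢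
  rw [inv_mul_eq_div, le_div_iff₀ hpi] at hlog ⊢
  have h3 : A * q * (Real.log ‖f c‖ * (2 * Real.pi)) ≤
      A * q * ∫ θ in (0 : ℝ)..2 * Real.pi, Real.log ‖f (circleMap c R θ)‖ := by gcongr
  simp only [sub_zero, smul_eq_mul] at hmono
  linarith

/-- The sub-mean value property with extended nonnegative values, where no integrability has to be
discussed. -/
theorem AnalyticOnNhd.enorm_rpow_le_lintegral {f : ℂ → ℂ} {c : ℂ} {R q : ℝ} (hR : 0 < R)
    (hq : 0 < q) (hf : AnalyticOnNhd ℂ f (Metric.closedBall c R)) :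
    ENNReal.ofReal (2 * Real.pi) * ‖f c‖ₑ ^ q ≤
      ∫⁻ θ in Set.Ioo (-Real.pi) Real.pi, ‖f (circleMap c R θ)‖ₑ ^ q := by
  have h := hf.norm_rpow_le_circleAverage hR hq
  have hpi := Real.two_pi_pos
  rw [Real.circleAverage_eq_integral_add (-Real.pi), smul_eq_mul,
    intervalIntegral.integral_comp_add_right
      (fun θ => ‖f (circleMap c R θ)‖ ^ q), inv_mul_eq_div, le_div_iff₀ hpi] at h
  have e : (2 * Real.pi + -Real.pi) = Real.pi := by ring
  have hcont : Continuous fun θ => ‖f (circleMap c R θ)‖ ^ q := by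
    refine Continuous.rpow_const ?_ fun _ => Or.inr hq.le
    refine Continuous.norm (hf.continuousOn.comp_continuous (continuous_circleMap c R) fun θ => ?_)
    exact Metric.sphere_subset_closedBall (circleMap_mem_sphere c hR.le θ)
  rw [zero_add, e, intervalIntegral.integral_of_le (by linarith [Real.pi_pos]),
    integral_Ioc_eq_integral_Ioo] at h
  have hconv : ∀ z : ℂ, ‖z‖ₑ ^ q = ENNReal.ofReal (‖z‖ ^ q) := fun z => by
    rw [← ofReal_norm, ENNReal.ofReal_rpow_of_nonneg (norm_nonneg z) hq.le]
  simp only [hconv]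
  rw [← ofReal_integral_eq_lintegral_ofReal, ← ENNReal.ofReal_mul hpi.le]
  · exact ENNReal.ofReal_le_ofReal (by linarith)
  · exact (hcont.integrableOn_Icc).mono_set Set.Ioo_subset_Icc_self
  · exact ae_of_all _ fun θ => by positivity

/-! ### Boundedness of Hardy space functions inside the half-plane -/

theorem isOpen_halfPlane : IsOpen halfPlane := isOpen_lt continuous_const Complex.continuous_re

/-- Integration in polar coordinates over the disc of centre `c` and radius `ε`. -/
theorem lintegral_circleMap_mul_le {h : ℂ → ℝ≥0∞} (hh : Measurable h) (c : ℂ) (ε : ℝ) :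
    ∫⁻ r in Set.Ioo 0 ε, ∫⁻ θ in Set.Ioo (-Real.pi) Real.pi,
      ENNReal.ofReal r * h (circleMap c r θ) ≤ ∫⁻ z, h z := by
  have hm : Measurable fun x : ℝ × ℝ => ENNReal.ofReal x.1 * h (circleMap c x.1 x.2) := by
    refine (by fun_prop : Measurable fun x : ℝ × ℝ => ENNReal.ofReal x.1).mul (hh.comp ?_)
    unfold circleMap
    fun_prop
  rw [← lintegral_prod (f := fun x : ℝ × ℝ => ENNReal.ofReal x.1 * h (circleMap c x.1 x.2))
    hm.aemeasurable, Measure.prod_restrict, ← lintegral_add_left_eq_self (fun z => h z) c,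
    ← Complex.lintegral_comp_polarCoord_symm]
  calc _ ≤ ∫⁻ x in polarCoord.target, ENNReal.ofReal x.1 * h (circleMap c x.1 x.2) := by
        refine lintegral_mono_set ?_
        rw [polarCoord_target]
        exact Set.prod_mono (fun x hx => hx.1) le_rfl
    _ = _ := by
        refine lintegral_congr fun x => ?_
        rw [smul_eq_mul, Complex.polarCoord_symm_apply, circleMap, Complex.exp_mul_I,
          Complex.ofReal_cos, Complex.ofReal_sin]

theorem lintegral_vertical_le_hardyNorm {p : ℝ} (hp : 0 < p) (f : ℂ → ℂ) {σ : ℝ}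
    (hσ : 1 / 2 < σ) :
    ∫⁻ t : ℝ, ‖f (σ + Complex.I * t)‖ₑ ^ p ≤ hardyNorm p f ^ p := by
  have h : (∫⁻ t : ℝ, ‖f (σ + Complex.I * t)‖ₑ ^ p) ^ (1 / p) ≤ hardyNorm p f :=
    le_iSup₂_of_le σ hσ le_rfl
  have h2 := ENNReal.rpow_le_rpow h hp.le
  rwa [← ENNReal.rpow_mul, one_div_mul_cancel hp.ne', ENNReal.rpow_one] at h2

/-- Averaging the sub-mean value property over the radii gives
`‖f s‖ ^ p ≲ ε⁻² ∫_{|z - s| < ε} ‖f z‖ ^ p`, and the disc lies in a strip of width `2 ε`, over which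
the integral is at most `2 ε ‖f‖ ^ p`. -/
theorem MemHardy.exists_bound {p : ℝ} (hp : 0 < p) {f : ℂ → ℂ} (hf : MemHardy p f) {ε : ℝ}
    (hε : 0 < ε) : ∃ M : ℝ, ∀ s : ℂ, 1 / 2 + ε ≤ s.re → ‖f s‖ ≤ M := by
  set H := hardyNorm p f ^ p
  have hH : H ≠ ∞ := ENNReal.rpow_ne_top_of_nonneg hp.le hf.2.ne
  set K : ℝ≥0∞ := ENNReal.ofReal (ε / 2) * (ENNReal.ofReal (ε / 2) * ENNReal.ofReal (2 * Real.pi))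
  have hK0 : K ≠ 0 := by
    have := Real.pi_pos
    simp [K, hε, this]
  have hKtop : K ≠ ∞ := by
    simp only [K]
    exact ENNReal.mul_ne_top ENNReal.ofReal_ne_top
      (ENNReal.mul_ne_top ENNReal.ofReal_ne_top ENNReal.ofReal_ne_top)
  have key : ∀ s : ℂ, 1 / 2 + ε ≤ s.re →
      K * ‖f s‖ₑ ^ p ≤ ENNReal.ofReal (2 * ε) * H := by
    intro s hs
    set S : Set ℂ := {z | s.re - ε < z.re ∧ z.re < s.re + ε}
    have hSo : IsOpen S := (isOpen_lt continuous_const Complex.continuous_re).inter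
      (isOpen_lt Complex.continuous_re continuous_const)
    have hSH : S ⊆ halfPlane := fun z hz => by
      have := hz.1
      simp only [halfPlane, Set.mem_ofPred_eq]
      linarith
    set h : ℂ → ℝ≥0∞ := S.indicator fun z => ‖f z‖ₑ ^ p
    have hh : Measurable h := by
      have hc : ContinuousOn (fun z => ‖f z‖ₑ ^ p) S :=
        ENNReal.continuous_rpow_const.comp_continuousOn
          (hf.1.continuousOn.mono hSH).enorm
      simpa only [h, ← Set.piecewise_eq_indicator] using
        hc.measurable_piecewise (g := 0) continuousOn_const hSo.measurableSet
    calc K * ‖f s‖ₑ ^ p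
        = ∫⁻ r in Set.Ioo (ε / 2) ε, ENNReal.ofReal (ε / 2) *
            (ENNReal.ofReal (2 * Real.pi) * ‖f s‖ₑ ^ p) := by
          rw [setLIntegral_const, Real.volume_Ioo]
          simp only [K]
          rw [show ε - ε / 2 = ε / 2 by ring]
          ring
      _ ≤ ∫⁻ r in Set.Ioo (ε / 2) ε, ∫⁻ θ in Set.Ioo (-Real.pi) Real.pi,
            ENNReal.ofReal r * h (circleMap s r θ) := by
          refine setLIntegral_mono' measurableSet_Ioo fun r hr => ?_
          have hr0 : 0 < r := by linarith [hr.1]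
          have hball : Metric.closedBall s r ⊆ S := fun z hz => by
            rw [Metric.mem_closedBall, dist_eq_norm] at hz
            have := (abs_le.mp ((Complex.abs_re_le_norm (z - s)).trans hz))
            rw [Complex.sub_re] at this
            exact ⟨by linarith [hr.2], by linarith [hr.2]⟩
          have han : AnalyticOnNhd ℂ f (Metric.closedBall s r) :=
            (hf.1.analyticOnNhd isOpen_halfPlane).mono (hball.trans hSH)
          have h1 := han.enorm_rpow_le_lintegral hr0 hp
          rw [lintegral_const_mul' _ _ ENNReal.ofReal_ne_top]
          refine mul_le_mul' (ENNReal.ofReal_le_ofReal hr.1.le) (h1.trans_eq ?_)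
          refine lintegral_congr fun θ => ?_
          refine (Set.indicator_of_mem ?_ (fun z => ‖f z‖ₑ ^ p)).symm
          exact hball (Metric.sphere_subset_closedBall (circleMap_mem_sphere s hr0.le θ))
      _ ≤ ∫⁻ r in Set.Ioo 0 ε, ∫⁻ θ in Set.Ioo (-Real.pi) Real.pi,
            ENNReal.ofReal r * h (circleMap s r θ) :=
          lintegral_mono_set (Set.Ioo_subset_Ioo_left (by positivity))
      _ ≤ ∫⁻ z, h z := lintegral_circleMap_mul_le hh s ε
      _ = ∫⁻ x : ℝ, ∫⁻ y : ℝ, h (x + Complex.I * y) := by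
          rw [← Complex.volume_preserving_equiv_real_prod.symm.lintegral_comp hh,
            Measure.volume_eq_prod, lintegral_prod]
          · refine lintegral_congr fun x => lintegral_congr fun y => ?_
            congr 1
            apply Complex.ext <;> simp
          · exact (hh.comp (Complex.measurableEquivRealProd.symm.measurable)).aemeasurable
      _ ≤ ∫⁻ x in Set.Ioo (s.re - ε) (s.re + ε), H := by
          rw [← lintegral_indicator measurableSet_Ioo]
          refine lintegral_mono fun x => ?_
          by_cases hx : x ∈ Set.Ioo (s.re - ε) (s.re + ε)
          · rw [Set.indicator_of_mem hx]
            refine le_trans (lintegral_mono fun y => Set.indicator_le_self _ _ _)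
              (lintegral_vertical_le_hardyNorm hp f (σ := x) ?_)
            linarith [hx.1]
          · rw [Set.indicator_of_notMem hx]
            refine (lintegral_eq_zero_iff' ?_).mpr ?_ |>.le
            · exact (hh.comp (by fun_prop)).aemeasurable
            · refine ae_of_all _ fun y => Set.indicator_of_notMem ?_ _
              simpa [S] using hx
      _ = ENNReal.ofReal (2 * ε) * H := by
          rw [setLIntegral_const, Real.volume_Ioo, mul_comm]
          congr 2
          ring
  set B : ℝ≥0∞ := (ENNReal.ofReal (2 * ε) * H / K) ^ (1 / p)
  have hB : B ≠ ∞ := ENNReal.rpow_ne_top_of_nonneg (by positivity)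
    (ENNReal.div_ne_top (ENNReal.mul_ne_top ENNReal.ofReal_ne_top hH) hK0)
  refine ⟨B.toReal, fun s hs => ?_⟩
  have h1 : ‖f s‖ₑ ^ p ≤ ENNReal.ofReal (2 * ε) * H / K := by
    rw [ENNReal.le_div_iff_mul_le (Or.inl hK0) (Or.inl hKtop), mul_comm]
    exact key s hs
  have h2 := ENNReal.rpow_le_rpow h1 (z := 1 / p) (by positivity)
  rw [← ENNReal.rpow_mul, mul_one_div_cancel hp.ne', ENNReal.rpow_one] at h2
  have h3 := ENNReal.toReal_mono hB h2
  simpa using h3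

/-! ### Domination by Poisson integrals -/

/-- The Poisson integral `∫ δ / (π (δ² + (t - x)²)) g(t) dt` of a nonnegative function `g`, at the
point at distance `δ` from the boundary line with ordinate `x`. -/
noncomputable def poissonIntegral (g : ℝ → ℝ≥0∞) (δ x : ℝ) : ℝ≥0∞ :=
  ∫⁻ t, ENNReal.ofReal (δ / (Real.pi * (δ ^ 2 + (t - x) ^ 2))) * g t

theorem one_sub_exp_div_one_add_exp_arctan (x : ℝ) :
    (1 - Complex.exp ((2 * Real.arctan x : ℝ) * Complex.I)) /
      (1 + Complex.exp ((2 * Real.arctan x : ℝ) * Complex.I)) = -(Complex.I * x) := by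
  set a := Real.arctan x
  have hc : Real.cos a ≠ 0 := (Real.cos_arctan_pos x).ne'
  have hx : x = Real.tan a := (Real.tan_arctan x).symm
  have hcc : Complex.cos a ≠ 0 := by exact_mod_cast hc
  have hsc := Complex.sin_sq_add_cos_sq a
  have hI := Complex.I_sq
  have he : Complex.exp ((2 * a : ℝ) * Complex.I) =
      (Complex.cos a + Complex.sin a * Complex.I) ^ 2 := by
    rw [← Complex.exp_mul_I, ← Complex.exp_nat_mul]
    push_cast
    ring_nf
  have h1 : 1 + Complex.exp ((2 * a : ℝ) * Complex.I) =
      2 * Complex.cos a * Complex.exp (a * Complex.I) := by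
    rw [he, Complex.exp_mul_I]
    linear_combination -hsc + Complex.sin a ^ 2 * hI
  have h2 : 1 - Complex.exp ((2 * a : ℝ) * Complex.I) =
      -(2 * Complex.I * Complex.sin a * Complex.exp (a * Complex.I)) := by
    rw [he, Complex.exp_mul_I]
    linear_combination -hsc + Complex.sin a ^ 2 * hI
  have h3 := Complex.exp_ne_zero (a * Complex.I)
  rw [h1, h2, hx, Complex.ofReal_tan, Complex.tan_eq_sin_div_cos]
  field_simp

/-- The change of variables `θ = 2 arctan ((x - t) / δ)`, the boundary correspondence of a conformal
map from the disc onto a half-plane: it takes the arc length to the Poisson kernel. -/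
theorem lintegral_comp_two_arctan (h : ℝ → ℝ≥0∞) {δ : ℝ} (hδ : 0 < δ) (x : ℝ) :
    ∫⁻ θ in Set.Ioo (-Real.pi) Real.pi, h θ =
      ∫⁻ t, ENNReal.ofReal (2 * δ / (δ ^ 2 + (t - x) ^ 2)) *
        h (2 * Real.arctan ((x - t) / δ)) := by
  have himg : Set.Ioo (-Real.pi) Real.pi =
      (fun t => 2 * Real.arctan ((x - t) / δ)) '' Set.univ := by
    ext θ
    constructor
    · rintro ⟨h1, h2⟩
      refine ⟨x - δ * Real.tan (θ / 2), trivial, ?_⟩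
      simp only [sub_sub_cancel]
      rw [mul_div_cancel_left₀ _ hδ.ne', Real.arctan_tan (by linarith) (by linarith)]
      ring
    · rintro ⟨t, -, rfl⟩
      have h1 := Real.neg_pi_div_two_lt_arctan ((x - t) / δ)
      have h2 := Real.arctan_lt_pi_div_two ((x - t) / δ)
      exact ⟨by simp only; linarith, by simp only; linarith⟩
  rw [himg, lintegral_image_eq_lintegral_abs_deriv_mul MeasurableSet.univ
    (f' := fun t => -(2 * δ / (δ ^ 2 + (t - x) ^ 2)))]
  · rw [Measure.restrict_univ]
    refine lintegral_congr fun t => ?_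
    rw [abs_neg, abs_of_nonneg (by positivity)]
  · intro t _
    have h1 : HasDerivAt (fun t => (x - t) / δ) (-1 / δ) t :=
      ((hasDerivAt_id t).const_sub x).div_const δ
    convert! (h1.arctan.const_mul 2).hasDerivWithinAt using 1
    field_simp
    ring
  · intro a _ b _ hab
    have h1 := Real.arctan_injective (mul_left_cancel₀ two_ne_zero hab)
    have h2 := (div_left_inj' hδ.ne').mp h1
    linarith

/-- Powers of the modulus of a holomorphic function, bounded on `Re s ≥ σ`, are dominated by the
Poisson integral of their values on the line `Re s = σ`. The proof transplants `f` to the unit disc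
by a conformal map taking `0` to the given point, applies the sub-mean value property at `0`, and
lets the radius of the circle tend to `1`. -/
theorem enorm_rpow_le_poissonIntegral {f : ℂ → ℂ} (hf : DifferentiableOn ℂ f halfPlane)
    {q : ℝ} (hq : 0 < q) {σ M : ℝ} (hσ : 1 / 2 < σ) (hM : ∀ s : ℂ, σ ≤ s.re → ‖f s‖ ≤ M)
    {δ : ℝ} (hδ : 0 < δ) (x : ℝ) :
    ‖f ((σ + δ : ℝ) + Complex.I * x)‖ₑ ^ q ≤
      poissonIntegral (fun t => ‖f (σ + Complex.I * t)‖ₑ ^ q) δ x := by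
  -- the conformal map from the unit disc onto `Re s > σ`, with `-1` going to infinity
  set φ : ℂ → ℂ := fun z => σ + Complex.I * x + δ * ((1 - z) / (1 + z))
  have hre : ∀ z : ℂ, (φ z).re = σ + δ * ((1 - ‖z‖ ^ 2) / Complex.normSq (1 + z)) := by
    intro z
    have : ((1 - z) / (1 + z)).re = (1 - ‖z‖ ^ 2) / Complex.normSq (1 + z) := by
      rw [Complex.div_re, Complex.sq_norm, Complex.normSq_apply z]
      simp only [Complex.sub_re, Complex.one_re, Complex.add_re, Complex.sub_im, Complex.one_im,
        Complex.add_im]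
      ring
    simp [φ, this]
  have hre' : ∀ z : ℂ, ‖z‖ ≤ 1 → σ ≤ (φ z).re := by
    intro z hz
    rw [hre]
    have : 0 ≤ (1 - ‖z‖ ^ 2) / Complex.normSq (1 + z) := by
      refine div_nonneg ?_ (Complex.normSq_nonneg _)
      nlinarith [norm_nonneg z]
    nlinarith
  have hmem : ∀ z : ℂ, ‖z‖ ≤ 1 → φ z ∈ halfPlane := fun z hz => hσ.trans_le (hre' z hz)
  have hφan : ∀ z : ℂ, 1 + z ≠ 0 → AnalyticAt ℂ φ z := by
    intro z hz
    have : AnalyticAt ℂ (fun z : ℂ => (1 - z) / (1 + z)) z := by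
      refine AnalyticAt.div (by fun_prop) (by fun_prop) hz
    exact analyticAt_const.add (analyticAt_const.mul this)
  have hne : ∀ z : ℂ, ‖z‖ < 1 → 1 + z ≠ 0 := by
    intro z hz h0
    have : z = -1 := by linear_combination h0
    simp [this] at hz
  have hfan := hf.analyticOnNhd isOpen_halfPlane
  set ρ : ℕ → ℝ := fun n => 1 - 1 / (n + 2)
  have hρ0 : ∀ n, 0 < ρ n := fun n => by
    simp only [ρ]
    rw [sub_pos, div_lt_one (by positivity)]
    linarith [n.cast_nonneg (α := ℝ)]
  have hρ1 : ∀ n, ρ n < 1 := fun n => by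
    simp only [ρ]
    have : (0 : ℝ) < 1 / (n + 2) := by positivity
    linarith
  have hρ : Tendsto ρ atTop (𝓝 1) := by
    have h1 : Tendsto (fun n : ℕ => (1 : ℝ) / (n + 2)) atTop (𝓝 0) := by
      refine tendsto_const_nhds.div_atTop ?_
      exact tendsto_atTop_add_const_right _ _ tendsto_natCast_atTop_atTop
    simpa [ρ] using h1.const_sub 1
  have hball : ∀ n, ∀ z ∈ Metric.closedBall (0 : ℂ) (ρ n), ‖z‖ < 1 := fun n z hz =>
    (mem_closedBall_zero_iff.mp hz).trans_lt (hρ1 n)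
  have han : ∀ n, AnalyticOnNhd ℂ (f ∘ φ) (Metric.closedBall 0 (ρ n)) := fun n z hz =>
    (hfan _ (hmem z (hball n z hz).le)).comp (hφan z (hne z (hball n z hz)))
  have hle : ∀ n, ENNReal.ofReal (2 * Real.pi) * ‖f (φ 0)‖ₑ ^ q ≤
      ∫⁻ θ in Set.Ioo (-Real.pi) Real.pi, ‖f (φ (circleMap 0 (ρ n) θ))‖ₑ ^ q :=
    fun n => (han n).enorm_rpow_le_lintegral (hρ0 n) hq
  have hlim : Tendsto (fun n => ∫⁻ θ in Set.Ioo (-Real.pi) Real.pi,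
        ‖f (φ (circleMap 0 (ρ n) θ))‖ₑ ^ q) atTop
      (𝓝 (∫⁻ θ in Set.Ioo (-Real.pi) Real.pi, ‖f (φ (Complex.exp (θ * Complex.I)))‖ₑ ^ q)) := by
    refine tendsto_lintegral_of_dominated_convergence (fun _ => ENNReal.ofReal M ^ q) ?_ ?_ ?_ ?_
    · intro n
      have hc : Continuous fun θ => f (φ (circleMap 0 (ρ n) θ)) :=
        (han n).continuousOn.comp_continuous (continuous_circleMap 0 (ρ n)) fun θ =>
          Metric.sphere_subset_closedBall (circleMap_mem_sphere 0 (hρ0 n).le θ)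
      exact (ENNReal.continuous_rpow_const.comp hc.enorm).measurable
    · intro n
      refine ae_of_all _ fun θ => ENNReal.rpow_le_rpow ?_ hq.le
      rw [← ofReal_norm]
      refine ENNReal.ofReal_le_ofReal (hM _ (hre' _ ?_))
      simpa using (abs_of_pos (hρ0 n)).trans_le (hρ1 n).le
    · rw [setLIntegral_const]
      refine ENNReal.mul_ne_top (ENNReal.rpow_ne_top_of_nonneg hq.le ENNReal.ofReal_ne_top) ?_
      simp
    · filter_upwards [ae_restrict_mem measurableSet_Ioo] with θ hθ
      have hz : 1 + Complex.exp (θ * Complex.I) ≠ 0 := by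
        intro h0
        have hcos : Real.cos θ = -1 := by
          have := congrArg Complex.re h0
          rw [Complex.add_re, Complex.exp_ofReal_mul_I_re, Complex.one_re, Complex.zero_re] at this
          linarith
        have h2 : Real.cos (θ / 2) ^ 2 = 0 := by
          have := Real.cos_sq (θ / 2)
          rw [mul_div_cancel₀ θ two_ne_zero, hcos] at this
          linarith
        have h3 : 0 < Real.cos (θ / 2) :=
          Real.cos_pos_of_mem_Ioo ⟨by linarith [hθ.1], by linarith [hθ.2]⟩
        exact h3.ne' (pow_eq_zero_iff two_ne_zero |>.mp h2)
      have hcm : Tendsto (fun n => circleMap 0 (ρ n) θ) atTop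
          (𝓝 (Complex.exp (θ * Complex.I))) := by
        have h1 : Tendsto (fun n => (ρ n : ℂ) * Complex.exp (θ * Complex.I)) atTop
            (𝓝 ((1 : ℝ) * Complex.exp (θ * Complex.I))) :=
          ((Complex.continuous_ofReal.tendsto 1).comp hρ).mul_const _
        simpa [circleMap] using h1
      have hfc : ContinuousAt (fun z => ‖f (φ z)‖ₑ ^ q) (Complex.exp (θ * Complex.I)) := by
        have : ContinuousAt (f ∘ φ) (Complex.exp (θ * Complex.I)) :=
          ((hfan _ (hmem _ (Complex.norm_exp_ofReal_mul_I θ).le)).comp (hφan _ hz)).continuousAt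
        exact ENNReal.continuous_rpow_const.continuousAt.comp this.enorm
      exact hfc.tendsto.comp hcm
  have hfin := ge_of_tendsto' hlim hle
  have hφ0 : φ 0 = (σ + δ : ℝ) + Complex.I * x := by
    simp [φ]
    ring
  rw [hφ0, lintegral_comp_two_arctan _ hδ x] at hfin
  have hpi := Real.pi_pos
  have h2pi : ENNReal.ofReal (2 * Real.pi) ≠ 0 := by simpa using hpi
  refine (ENNReal.mul_le_mul_iff_right h2pi ENNReal.ofReal_ne_top).mp (hfin.trans_eq ?_)
  rw [poissonIntegral, ← lintegral_const_mul' _ _ ENNReal.ofReal_ne_top]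
  refine lintegral_congr fun t => ?_
  rw [← mul_assoc, ← ENNReal.ofReal_mul (by positivity)]
  congr 2
  · field_simp
  · simp only [φ]
    rw [one_sub_exp_div_one_add_exp_arctan]
    have hδ' : (δ : ℂ) ≠ 0 := by exact_mod_cast hδ.ne'
    congr 2
    push_cast
    field_simp
    ring

/-! ### Poisson integrals and Carleson boxes -/

/-- The Carleson box of side length `δ`, resting on the boundary line at the ordinate `t`. -/
def carlesonBox (δ t : ℝ) : Set halfPlane :=
  {s | (s : ℂ).re ≤ 1 / 2 + δ ∧ |(s : ℂ).im - t| ≤ δ}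

/-- The Poisson integral is controlled by the averages of `g` over intervals of length at least
`2 δ`: the Poisson kernel is at most `∑ 2 / (4 ^ k δ)` times the indicator function of
`[x - 2 ^ k δ, x + 2 ^ k δ]`. -/
theorem poissonIntegral_le_of_forall_average_le {g : ℝ → ℝ≥0∞} (hg : Measurable g) {δ x : ℝ}
    (hδ : 0 < δ) {a : ℝ≥0∞}
    (h : ∀ r, δ ≤ r → ∫⁻ t in Metric.closedBall x r, g t ≤ ENNReal.ofReal r * a) :
    poissonIntegral g δ x ≤ 4 * a := by
  have hpt : ∀ t, ENNReal.ofReal (δ / (Real.pi * (δ ^ 2 + (t - x) ^ 2))) * g t ≤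
      ∑' k : ℕ, ENNReal.ofReal (2 / (4 ^ k * δ)) *
        (Metric.closedBall x (2 ^ k * δ)).indicator g t := by
    intro t
    have hex : ∃ k : ℕ, |t - x| ≤ 2 ^ k * δ := by
      obtain ⟨k, hk⟩ := pow_unbounded_of_one_lt (|t - x| / δ) one_lt_two
      exact ⟨k, ((div_lt_iff₀ hδ).mp hk).le⟩
    classical
    set k := Nat.find hex
    have hk : |t - x| ≤ 2 ^ k * δ := Nat.find_spec hex
    refine le_trans ?_ (ENNReal.le_tsum k)
    rw [Set.indicator_of_mem (by simpa [Real.dist_eq] using hk)]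
    refine mul_le_mul_left (ENNReal.ofReal_le_ofReal ?_) _
    have hpi := Real.pi_gt_three
    rw [div_le_div_iff₀ (by positivity) (by positivity)]
    rcases Nat.eq_zero_or_pos k with h0 | h0
    · rw [h0]
      nlinarith [sq_nonneg (t - x), sq_nonneg δ, mul_nonneg Real.pi_pos.le (sq_nonneg (t - x))]
    · obtain ⟨j, hj⟩ := Nat.exists_eq_succ_of_ne_zero h0.ne'
      have hlt : 2 ^ j * δ < |t - x| := not_le.mp (Nat.find_min hex (m := j) (by omega))
      have hsq : (2 ^ j * δ) ^ 2 < (t - x) ^ 2 := by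
        rw [← sq_abs (t - x)]
        exact pow_lt_pow_left₀ hlt (by positivity) two_ne_zero
      have h4 : (4 : ℝ) ^ k * δ ^ 2 = 4 * (2 ^ j * δ) ^ 2 := by
        rw [hj, pow_succ, mul_pow, ← pow_mul, mul_comm j 2, pow_mul]
        norm_num
        ring
      nlinarith [sq_nonneg δ, sq_nonneg (t - x), mul_pos hδ hδ]
  calc poissonIntegral g δ x
      ≤ ∫⁻ t, ∑' k : ℕ, ENNReal.ofReal (2 / (4 ^ k * δ)) *
        (Metric.closedBall x (2 ^ k * δ)).indicator g t := lintegral_mono hpt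
    _ = ∑' k : ℕ, ENNReal.ofReal (2 / (4 ^ k * δ)) *
        ∫⁻ t in Metric.closedBall x (2 ^ k * δ), g t := by
        rw [lintegral_tsum fun k =>
          ((hg.indicator Metric.isClosed_closedBall.measurableSet).const_mul _).aemeasurable]
        refine tsum_congr fun k => ?_
        rw [lintegral_const_mul' _ _ ENNReal.ofReal_ne_top,
          lintegral_indicator Metric.isClosed_closedBall.measurableSet]
    _ ≤ ∑' k : ℕ, ENNReal.ofReal (2 / (4 ^ k * δ)) * (ENNReal.ofReal (2 ^ k * δ) * a) := by
        refine ENNReal.tsum_le_tsum fun k => mul_le_mul_right (h _ ?_) _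
        exact le_mul_of_one_le_left hδ.le (one_le_pow₀ one_le_two)
    _ = ∑' k : ℕ, ENNReal.ofReal (2 * (1 / 2) ^ k) * a := by
        refine tsum_congr fun k => ?_
        rw [← mul_assoc, ← ENNReal.ofReal_mul (by positivity)]
        congr 2
        have : (4 : ℝ) ^ k = 2 ^ k * 2 ^ k := by rw [← mul_pow]; norm_num
        rw [this, one_div, inv_pow]
        field_simp
    _ = 4 * a := by
        rw [ENNReal.tsum_mul_right, ← ENNReal.ofReal_tsum_of_nonneg (fun k => by positivity)
          (summable_geometric_two.mul_left 2), tsum_mul_left, tsum_geometric_two]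
        norm_num

theorem exists_average_gt_of_lt_poissonIntegral {g : ℝ → ℝ≥0∞} (hg : Measurable g) {δ x : ℝ}
    (hδ : 0 < δ) {a : ℝ≥0∞} (h : 4 * a < poissonIntegral g δ x) :
    ∃ r, δ ≤ r ∧ ENNReal.ofReal r * a < ∫⁻ t in Metric.closedBall x r, g t := by
  by_contra! hcon
  exact h.not_ge (poissonIntegral_le_of_forall_average_le hg hδ hcon)

theorem poissonIntegral_mono {g h : ℝ → ℝ≥0∞} (hgh : ∀ t, g t ≤ h t) (δ x : ℝ) :
    poissonIntegral g δ x ≤ poissonIntegral h δ x :=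
  lintegral_mono fun t => mul_le_mul_right (hgh t) _

theorem poissonIntegral_add {g h : ℝ → ℝ≥0∞} (hg : Measurable g) (δ x : ℝ) :
    poissonIntegral (fun t => g t + h t) δ x =
      poissonIntegral g δ x + poissonIntegral h δ x := by
  simp only [poissonIntegral, mul_add]
  exact lintegral_add_left (by fun_prop) _

theorem poissonIntegral_const_le {δ : ℝ} (hδ : 0 < δ) (x : ℝ) (b : ℝ≥0∞) :
    poissonIntegral (fun _ => b) δ x ≤ 8 * b := by
  refine (poissonIntegral_le_of_forall_average_le (a := 2 * b) measurable_const hδ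
    fun r hr => ?_).trans_eq ?_
  · rw [setLIntegral_const, Real.volume_closedBall, ENNReal.ofReal_mul zero_le_two]
    norm_num
    ring_nf
    exact le_rfl
  · rw [← mul_assoc]
    norm_num

/-- The Poisson integral is of weak type `(1, 1)` with respect to a measure satisfying the box
condition. Where it exceeds `4 a`, some interval of radius `r` at least the distance from the
boundary has `∫ g > r a`; Vitali's lemma selects disjoint ones among these intervals, and the boxes
of side `5 r` over them cover. -/
theorem mul_measure_lt_poissonIntegral_le {μ : Measure halfPlane} {A : ℝ≥0∞} (hA : A ≠ 0)
    (hμ : ∀ δ t, 0 < δ → μ (carlesonBox δ t) ≤ A * ENNReal.ofReal δ)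
    {g : ℝ → ℝ≥0∞} (hg : Measurable g) {a : ℝ≥0∞} (ha : a ≠ 0) (ha' : a ≠ ∞) :
    a * μ {s | 4 * a < poissonIntegral g ((s : ℂ).re - 1 / 2) (s : ℂ).im} ≤
      5 * A * ∫⁻ t, g t := by
  by_cases htop : ∫⁻ t, g t = ∞
  · rw [htop, ENNReal.mul_top (mul_ne_zero (by norm_num) hA)]
    exact le_top
  set E : Set halfPlane := {s | 4 * a < poissonIntegral g ((s : ℂ).re - 1 / 2) (s : ℂ).im}
  have hpos : ∀ s : halfPlane, 0 < (s : ℂ).re - 1 / 2 := fun s => sub_pos.mpr s.2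
  have hex : ∀ s : halfPlane, ∃ r, (s : ℂ).re - 1 / 2 ≤ r ∧ (s ∈ E →
      ENNReal.ofReal r * a < ∫⁻ t in Metric.closedBall (s : ℂ).im r, g t) := by
    intro s
    by_cases hs : s ∈ E
    · obtain ⟨r, h1, h2⟩ := exists_average_gt_of_lt_poissonIntegral hg (hpos s) hs
      exact ⟨r, h1, fun _ => h2⟩
    · exact ⟨_, le_rfl, fun h => absurd h hs⟩
  choose r hr hrE using hex
  have hr0 : ∀ s, 0 < r s := fun s => (hpos s).trans_le (hr s)
  have hbound : ∀ s ∈ E, r s ≤ ((∫⁻ t, g t) / a).toReal := by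
    intro s hs
    rw [← ENNReal.ofReal_le_iff_le_toReal (ENNReal.div_ne_top htop ha),
      ENNReal.le_div_iff_mul_le (Or.inl ha) (Or.inl ha')]
    exact (hrE s hs).le.trans (setLIntegral_le_lintegral _ _)
  obtain ⟨u, huE, hdisj, hcov⟩ := Vitali.exists_disjoint_subfamily_covering_enlargement_closedBall
    E (fun s => (s : ℂ).im) r _ hbound 5 (by norm_num)
  have hucount : u.Countable := by
    refine hdisj.countable_of_nonempty_interior fun s _ => ?_
    refine ⟨(s : ℂ).im, ?_⟩
    rw [interior_closedBall _ (hr0 s).ne']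
    exact Metric.mem_ball_self (hr0 s)
  have hsub : E ⊆ ⋃ b ∈ u, carlesonBox (5 * r b) (b : ℂ).im := by
    intro s hs
    obtain ⟨b, hb, hsb⟩ := hcov s hs
    refine Set.mem_biUnion hb ?_
    have h1 := @hsb ((s : ℂ).im + r s) (by simp [abs_of_pos (hr0 s)])
    have h2 := @hsb ((s : ℂ).im - r s) (by simp [abs_of_pos (hr0 s)])
    rw [Metric.mem_closedBall, Real.dist_eq, abs_le] at h1 h2
    have h3 := hr s
    have h4 := hr0 s
    refine ⟨?_, abs_le.mpr ⟨?_, ?_⟩⟩ <;> linarith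
  calc a * μ E ≤ a * ∑' b : u, μ (carlesonBox (5 * r b) ((b : halfPlane) : ℂ).im) := by
        refine mul_le_mul_right ((measure_mono hsub).trans ?_) _
        exact measure_biUnion_le μ hucount _
    _ ≤ a * ∑' b : u, A * ENNReal.ofReal (5 * r b) := by
        refine mul_le_mul_right (ENNReal.tsum_le_tsum fun b => hμ _ _ ?_) _
        have := hr0 b
        positivity
    _ = 5 * A * ∑' b : u, ENNReal.ofReal (r b) * a := by
        rw [← ENNReal.tsum_mul_left, ← ENNReal.tsum_mul_left]
        refine tsum_congr fun b => ?_
        rw [ENNReal.ofReal_mul (by norm_num)]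
        norm_num
        ring
    _ ≤ 5 * A * ∑' b : u, ∫⁻ t in Metric.closedBall ((b : halfPlane) : ℂ).im (r b), g t :=
        mul_le_mul_right (ENNReal.tsum_le_tsum fun b : u => (hrE b.1 (huE b.2)).le) _
    _ = 5 * A * ∫⁻ t in ⋃ b ∈ u, Metric.closedBall (b : ℂ).im (r b), g t := by
        rw [lintegral_biUnion hucount
          (fun b _ => Metric.isClosed_closedBall.measurableSet) hdisj]
    _ ≤ 5 * A * ∫⁻ t, g t := mul_le_mul_right (setLIntegral_le_lintegral _ _) _

/-- The Poisson integral is of strong type `(2, 2)` with respect to a measure satisfying the box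
condition: at the level `l`, the part of `g` below `l / 16` contributes at most `l / 2`, and the
weak type estimate is applied to the rest. -/
theorem lintegral_sq_le_of_le_poissonIntegral {μ : Measure halfPlane} {A : ℝ≥0∞} (hA : A ≠ 0)
    (hμ : ∀ δ t, 0 < δ → μ (carlesonBox δ t) ≤ A * ENNReal.ofReal δ)
    {g : ℝ → ℝ≥0∞} (hg : Measurable g) {u : halfPlane → ℝ} (hu : Measurable u)
    (hu0 : ∀ s, 0 ≤ u s)
    (hug : ∀ s : halfPlane,
      ENNReal.ofReal (u s) ≤ poissonIntegral g ((s : ℂ).re - 1 / 2) (s : ℂ).im) :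
    ∫⁻ s, ENNReal.ofReal (u s ^ (2 : ℝ)) ∂μ ≤ 1280 * A * ∫⁻ t, g t ^ (2 : ℝ) := by
  have hlevel : ∀ l : ℝ, 0 < l → μ {s | l < u s} * ENNReal.ofReal (l ^ ((2 : ℝ) - 1)) ≤
      40 * A * ∫⁻ t, {t | ENNReal.ofReal (l / 16) < g t}.indicator g t := by
    intro l hl
    set S := {t | ENNReal.ofReal (l / 16) < g t}
    have hS : MeasurableSet S := measurableSet_lt measurable_const hg
    have hweak := mul_measure_lt_poissonIntegral_le hA hμ (hg.indicator hS)
      (a := ENNReal.ofReal (l / 8)) (by simpa using hl) ENNReal.ofReal_ne_top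
    have hsub : {s | l < u s} ⊆ {s : halfPlane | 4 * ENNReal.ofReal (l / 8) <
        poissonIntegral (S.indicator g) ((s : ℂ).re - 1 / 2) (s : ℂ).im} := by
      intro s hs
      have hs' : l < u s := hs
      have hpos : 0 < (s : ℂ).re - 1 / 2 := sub_pos.mpr s.2
      have h1 : ENNReal.ofReal l < ENNReal.ofReal (u s) :=
        (ENNReal.ofReal_lt_ofReal_iff (hl.trans hs')).mpr hs'
      have h2 : poissonIntegral g ((s : ℂ).re - 1 / 2) (s : ℂ).im ≤
          poissonIntegral (S.indicator g) ((s : ℂ).re - 1 / 2) (s : ℂ).im +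
            ENNReal.ofReal (l / 2) := by
        calc _ ≤ poissonIntegral (fun t => S.indicator g t + ENNReal.ofReal (l / 16))
              ((s : ℂ).re - 1 / 2) (s : ℂ).im := by
              refine poissonIntegral_mono (fun t => ?_) _ _
              by_cases ht : t ∈ S
              · rw [Set.indicator_of_mem ht]
                exact le_self_add
              · rw [Set.indicator_of_notMem ht, zero_add]
                exact not_lt.mp ht
          _ ≤ _ := by
              rw [poissonIntegral_add (hg.indicator hS)]
              gcongr
              refine (poissonIntegral_const_le hpos _ _).trans_eq ?_
              rw [show (8 : ℝ≥0∞) = ENNReal.ofReal 8 by norm_num,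
                ← ENNReal.ofReal_mul (by norm_num)]
              congr 1
              ring
      have h3 := (h1.trans_le (hug s)).trans_le h2
      have hhalf : ENNReal.ofReal l = ENNReal.ofReal (l / 2) + ENNReal.ofReal (l / 2) := by
        rw [← ENNReal.ofReal_add (by positivity) (by positivity), add_halves]
      rw [hhalf] at h3
      have h4 := lt_of_add_lt_add_right h3
      show 4 * ENNReal.ofReal (l / 8) < _
      rw [show (4 : ℝ≥0∞) = ENNReal.ofReal 4 by norm_num, ← ENNReal.ofReal_mul (by norm_num)]
      convert h4 using 2
      · ring
    have h8 : ENNReal.ofReal (l ^ ((2 : ℝ) - 1)) = 8 * ENNReal.ofReal (l / 8) := by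
      rw [show (8 : ℝ≥0∞) = ENNReal.ofReal 8 by norm_num, ← ENNReal.ofReal_mul (by norm_num),
        show (2 : ℝ) - 1 = 1 by norm_num, Real.rpow_one, mul_div_cancel₀ l (by norm_num)]
    calc μ {s | l < u s} * ENNReal.ofReal (l ^ ((2 : ℝ) - 1))
        = 8 * (ENNReal.ofReal (l / 8) * μ {s | l < u s}) := by rw [h8]; ring
      _ ≤ 8 * (5 * A * ∫⁻ t, S.indicator g t) :=
          mul_le_mul_right ((mul_le_mul_right (measure_mono hsub) _).trans hweak) _
      _ = 40 * A * ∫⁻ t, S.indicator g t := by ring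
  have hvol : ∀ x : ℝ≥0∞, volume {l : ℝ | 0 < l ∧ ENNReal.ofReal (l / 16) < x} = 16 * x := by
    intro x
    by_cases hx : x = ∞
    · have : {l : ℝ | 0 < l ∧ ENNReal.ofReal (l / 16) < x} = Set.Ioi 0 := by
        ext l
        simp [hx]
      rw [this, hx, Real.volume_Ioi, ENNReal.mul_top (by norm_num)]
    · have : {l : ℝ | 0 < l ∧ ENNReal.ofReal (l / 16) < x} = Set.Ioo 0 (16 * x.toReal) := by
        ext l
        simp only [Set.mem_ofPred_eq, Set.mem_Ioo]
        refine and_congr_right fun hl => ?_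
        rw [ENNReal.ofReal_lt_iff_lt_toReal (by positivity) hx, div_lt_iff₀ (by norm_num), mul_comm]
      rw [this, Real.volume_Ioo, sub_zero, ENNReal.ofReal_mul (by norm_num),
        ENNReal.ofReal_toReal hx]
      norm_num
  have hmeas : MeasurableSet {x : ℝ × ℝ | ENNReal.ofReal (x.1 / 16) < g x.2} :=
    measurableSet_lt (by fun_prop) (by fun_prop)
  have hswap : ∫⁻ l in Set.Ioi (0 : ℝ), ∫⁻ t,
      {t | ENNReal.ofReal (l / 16) < g t}.indicator g t = 16 * ∫⁻ t, g t ^ (2 : ℝ) := by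
    rw [lintegral_lintegral_swap]
    · rw [← lintegral_const_mul _ (by fun_prop)]
      refine lintegral_congr fun t => ?_
      calc ∫⁻ l in Set.Ioi (0 : ℝ), {t | ENNReal.ofReal (l / 16) < g t}.indicator g t
          = ∫⁻ l in Set.Ioi (0 : ℝ),
              {l : ℝ | ENNReal.ofReal (l / 16) < g t}.indicator (fun _ => g t) l := rfl
        _ = g t * (16 * g t) := by
            rw [lintegral_indicator_const (measurableSet_lt (by fun_prop) measurable_const),
              Measure.restrict_apply (measurableSet_lt (by fun_prop) measurable_const), ← hvol]
            congr 2
            ext l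
            exact and_comm
        _ = 16 * g t ^ (2 : ℝ) := by
            rw [ENNReal.rpow_two]
            ring
    · exact ((hg.comp measurable_snd).indicator hmeas).aemeasurable
  rw [lintegral_rpow_eq_lintegral_meas_lt_mul μ (ae_of_all _ hu0) hu.aemeasurable two_pos]
  calc _ ≤ ENNReal.ofReal 2 * ∫⁻ l in Set.Ioi (0 : ℝ), 40 * A * ∫⁻ t,
        {t | ENNReal.ofReal (l / 16) < g t}.indicator g t :=
        mul_le_mul_right (setLIntegral_mono' measurableSet_Ioi hlevel) _
    _ = ENNReal.ofReal 2 * (40 * A * ∫⁻ l in Set.Ioi (0 : ℝ), ∫⁻ t,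
        {t | ENNReal.ofReal (l / 16) < g t}.indicator g t) := by
        rw [lintegral_const_mul]
        exact Measurable.lintegral_prod_right' (ν := volume)
          (f := fun x : ℝ × ℝ => {t | ENNReal.ofReal (x.1 / 16) < g t}.indicator g x.2)
          ((hg.comp measurable_snd).indicator hmeas)
    _ = _ := by
        rw [hswap]
        norm_num
        ring

/-! ### Carleson's embedding theorem -/

/-- **Carleson's embedding theorem**, sufficiency of the box condition. The function
`s ↦ f (s + ε)` is dominated by Poisson integrals of the values of `f` on the line
`Re s = 1 / 2 + ε`; then `ε` tends to `0`. -/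
theorem isCarlesonHardy_of_carlesonBox {p : ℝ} (hp : 0 < p) {μ : Measure halfPlane} {A : ℝ}
    (hA : 0 < A)
    (hμ : ∀ δ t, 0 < δ → μ (carlesonBox δ t) ≤ ENNReal.ofReal A * ENNReal.ofReal δ) :
    IsCarlesonHardy p μ := by
  refine ⟨1280 * A, by positivity, fun f hf => ?_⟩
  have hcont : ∀ ε : ℝ, 0 < ε → Continuous fun s : halfPlane => f (s + ε) := fun ε hε =>
    hf.1.continuousOn.comp_continuous (by fun_prop) fun s => by
      have h1 : 1 / 2 < (s : ℂ).re := s.2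
      have h2 : 1 / 2 < ((s : ℂ) + ε).re := by
        rw [Complex.add_re, Complex.ofReal_re]
        linarith
      exact h2
  have hsq : ∀ x : ℝ≥0∞, (x ^ (p / 2)) ^ (2 : ℝ) = x ^ p := fun x => by
    rw [← ENNReal.rpow_mul, div_mul_cancel₀ p two_ne_zero]
  have hreal : ∀ z : ℂ, ‖z‖ₑ ^ (p / 2) = ENNReal.ofReal (‖z‖ ^ (p / 2)) := fun z => by
    rw [← ofReal_norm, ENNReal.ofReal_rpow_of_nonneg (norm_nonneg z) (by positivity)]
  have hshift : ∀ ε : ℝ, 0 < ε → ∫⁻ s : halfPlane, ‖f (s + ε)‖ₑ ^ p ∂μ ≤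
      ENNReal.ofReal (1280 * A) * hardyNorm p f ^ p := by
    intro ε hε
    obtain ⟨M, hM⟩ := hf.exists_bound hp hε
    have hσ : 1 / 2 < 1 / 2 + ε := by linarith
    set g : ℝ → ℝ≥0∞ := fun t => ‖f ((1 / 2 + ε : ℝ) + Complex.I * t)‖ₑ ^ (p / 2)
    have hg : Measurable g := by
      have : Continuous fun t : ℝ => f ((1 / 2 + ε : ℝ) + Complex.I * t) :=
        hf.1.continuousOn.comp_continuous (by fun_prop) fun t => by
          simp only [halfPlane, Set.mem_ofPred_eq, Complex.add_re, Complex.ofReal_re,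
            Complex.mul_re, Complex.I_re, Complex.I_im, Complex.ofReal_im]
          linarith
      exact (ENNReal.continuous_rpow_const.comp this.enorm).measurable
    have hu : Measurable fun s : halfPlane => ‖f (s + ε)‖ ^ (p / 2) :=
      (((hcont ε hε).norm.rpow_const fun _ => Or.inr (by positivity))).measurable
    have h := lintegral_sq_le_of_le_poissonIntegral (μ := μ) (A := ENNReal.ofReal A)
      (by simpa using hA) hμ hg hu (fun s => by positivity) (fun s => by
        rw [← hreal]
        have hpos : 0 < (s : ℂ).re - 1 / 2 := sub_pos.mpr s.2
        convert! enorm_rpow_le_poissonIntegral hf.1 (q := p / 2) (by positivity) hσ hM hpos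
          (s : ℂ).im using 4
        · push_cast
          simp only [Complex.ext_iff]
          constructor
          · simp
            ring
          · simp)
    calc ∫⁻ s : halfPlane, ‖f (s + ε)‖ₑ ^ p ∂μ
        = ∫⁻ s : halfPlane, ENNReal.ofReal ((‖f (s + ε)‖ ^ (p / 2)) ^ (2 : ℝ)) ∂μ := by
          refine lintegral_congr fun s => ?_
          rw [← ENNReal.ofReal_rpow_of_nonneg (by positivity) zero_le_two, ← hreal, hsq]
      _ ≤ 1280 * ENNReal.ofReal A * ∫⁻ t, g t ^ (2 : ℝ) := h
      _ ≤ ENNReal.ofReal (1280 * A) * hardyNorm p f ^ p := by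
          rw [ENNReal.ofReal_mul (by norm_num)]
          refine mul_le_mul' (by norm_num) ?_
          simp only [g, hsq]
          exact lintegral_vertical_le_hardyNorm hp f hσ
  have hlim : ∀ s : halfPlane, Tendsto (fun n : ℕ => ‖f (s + ((1 / (n + 1) : ℝ) : ℂ))‖ₑ ^ p) atTop
      (𝓝 (‖f s‖ₑ ^ p)) := by
    intro s
    have h1 : Tendsto (fun n : ℕ => (s : ℂ) + ((1 / (n + 1) : ℝ) : ℂ)) atTop (𝓝 s) := by
      have := ((Complex.continuous_ofReal.tendsto 0).comp
        tendsto_one_div_add_atTop_nhds_zero_nat).const_add (s : ℂ)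
      simpa using this
    have h2 : ContinuousAt f s := (hf.1 s s.2).continuousWithinAt.continuousAt
      (isOpen_halfPlane.mem_nhds s.2)
    exact (ENNReal.continuous_rpow_const.tendsto _).comp ((h2.tendsto.comp h1).enorm)
  calc ∫⁻ s : halfPlane, ‖f s‖ₑ ^ p ∂μ
      = ∫⁻ s : halfPlane,
          liminf (fun n : ℕ => ‖f (s + ((1 / (n + 1) : ℝ) : ℂ))‖ₑ ^ p) atTop ∂μ :=
        lintegral_congr fun s => (hlim s).liminf_eq.symm
    _ ≤ liminf (fun n : ℕ =>
          ∫⁻ s : halfPlane, ‖f (s + ((1 / (n + 1) : ℝ) : ℂ))‖ₑ ^ p ∂μ) atTop :=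
        lintegral_liminf_le fun n =>
          (ENNReal.continuous_rpow_const.comp (hcont _ (by positivity)).enorm).measurable
    _ ≤ _ := by
        refine liminf_le_of_le (by isBoundedDefault) fun b hb => ?_
        obtain ⟨n, hn⟩ := hb.exists
        exact hn.trans (hshift _ (by positivity))

/-! ### Mean values and uniform limits of Dirichlet polynomials -/

theorem tendsto_mean_exp {l : ℝ} (hl : l ≠ 0) :
    Tendsto (fun T : ℝ => (1 / (2 * T) : ℂ) * ∫ t in (-T)..T, Complex.exp (Complex.I * l * t))
      atTop (𝓝 0) := by
  refine squeeze_zero_norm' (a := fun T => (1 / |l|) * T⁻¹) ?_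
    (by simpa using tendsto_inv_atTop_zero.const_mul (1 / |l|))
  filter_upwards [eventually_gt_atTop 0] with T hT
  rw [integral_exp_mul_complex (by simp [hl])]
  have h1 : ∀ x : ℝ, ‖Complex.exp (Complex.I * l * x)‖ = 1 := by
    intro x
    rw [show Complex.I * l * x = ((l * x : ℝ) : ℂ) * Complex.I by push_cast; ring,
      Complex.norm_exp_ofReal_mul_I]
  have h2 : ‖Complex.exp (Complex.I * l * T) - Complex.exp (Complex.I * l * (-T : ℝ))‖ ≤ 2 := by
    refine (norm_sub_le _ _).trans ?_
    rw [h1, h1]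
    norm_num
  have hl' : 0 < |l| := abs_pos.mpr hl
  rw [norm_mul, norm_div, norm_div, norm_mul, norm_mul]
  simp only [norm_one, Complex.norm_I, one_mul, Complex.norm_real, Real.norm_eq_abs,
    Complex.norm_ofNat, abs_of_pos hT]
  calc 1 / (2 * T) * (‖Complex.exp (Complex.I * l * T)
          - Complex.exp (Complex.I * l * (-T : ℝ))‖ / |l|)
      ≤ 1 / (2 * T) * (2 / |l|) := by gcongr
    _ = 1 / |l| * T⁻¹ := by field_simp

/-- Parseval's identity for trigonometric polynomials with real frequencies. -/
theorem tendsto_mean_norm_sq_sum_exp {ι : Type*} (S : Finset ι) {l : ι → ℝ}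
    (hl : Function.Injective l) (b : ι → ℂ) :
    Tendsto (fun T : ℝ => 1 / (2 * T) *
      ∫ t in (-T)..T, ‖∑ i ∈ S, b i * Complex.exp (Complex.I * l i * t)‖ ^ 2) atTop
      (𝓝 (∑ i ∈ S, ‖b i‖ ^ 2)) := by
  classical
  have hexp : ∀ t : ℝ, ((‖∑ i ∈ S, b i * Complex.exp (Complex.I * l i * t)‖ ^ 2 : ℝ) : ℂ) =
      ∑ i ∈ S, ∑ j ∈ S, b i * (starRingEnd ℂ) (b j) *
        Complex.exp (Complex.I * ((l i - l j : ℝ) : ℂ) * t) := by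
    intro t
    push_cast
    rw [← Complex.mul_conj', map_sum, Finset.sum_mul_sum]
    refine Finset.sum_congr rfl fun i _ => Finset.sum_congr rfl fun j _ => ?_
    rw [map_mul, ← Complex.exp_conj, map_mul, map_mul, Complex.conj_I, Complex.conj_ofReal,
      Complex.conj_ofReal, mul_mul_mul_comm, ← Complex.exp_add]
    congr 2
    ring
  have hterm : ∀ i j : ι, Tendsto (fun T : ℝ => (1 / (2 * T) : ℂ) *
      ∫ t in (-T)..T, Complex.exp (Complex.I * ((l i - l j : ℝ) : ℂ) * t)) atTop
      (𝓝 (if i = j then 1 else 0)) := by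
    intro i j
    by_cases hij : i = j
    · refine tendsto_const_nhds.congr' ?_
      filter_upwards [eventually_gt_atTop 0] with T hT
      have : (T : ℂ) ≠ 0 := by exact_mod_cast hT.ne'
      simp [hij]
      field_simp
      ring
    · rw [if_neg hij]
      exact tendsto_mean_exp (sub_ne_zero.mpr fun h => hij (hl h))
  have hC : Tendsto (fun T : ℝ => ((1 / (2 * T) *
      ∫ t in (-T)..T, ‖∑ i ∈ S, b i * Complex.exp (Complex.I * l i * t)‖ ^ 2 : ℝ) : ℂ)) atTop
      (𝓝 (∑ i ∈ S, ∑ j ∈ S, b i * (starRingEnd ℂ) (b j) * (if i = j then 1 else 0))) := by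
    refine (tendsto_finsetSum _ fun i _ => tendsto_finsetSum _ fun j _ =>
      (hterm i j).const_mul (b i * (starRingEnd ℂ) (b j))).congr fun T => ?_
    rw [Complex.ofReal_mul, ← intervalIntegral.integral_ofReal]
    simp only [hexp]
    rw [intervalIntegral.integral_finsetSum fun i _ =>
      Continuous.intervalIntegrable (by fun_prop) _ _, Finset.mul_sum]
    refine Finset.sum_congr rfl fun i _ => ?_
    rw [intervalIntegral.integral_finsetSum fun i _ =>
      Continuous.intervalIntegrable (by fun_prop) _ _, Finset.mul_sum]
    refine Finset.sum_congr rfl fun j _ => ?_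
    rw [intervalIntegral.integral_const_mul]
    push_cast
    ring
  have hval : ∑ i ∈ S, ∑ j ∈ S, b i * (starRingEnd ℂ) (b j) * (if i = j then 1 else 0) =
      ((∑ i ∈ S, ‖b i‖ ^ 2 : ℝ) : ℂ) := by
    push_cast
    refine Finset.sum_congr rfl fun i hi => ?_
    simp [hi, Complex.mul_conj']
  rw [hval] at hC
  exact (Complex.continuous_re.tendsto _).comp hC

theorem DirichletPoly.continuous_eval (P : DirichletPoly) :
    Continuous fun t : ℝ => P.eval (Complex.I * t) :=
  (trigPoly_continuous_and_mean P.eval_mem_trigPoly.1).1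

theorem DirichletPoly.tendsto_mean_rpow {p : ℝ} (hp : 0 < p) (P : DirichletPoly) :
    Tendsto (fun T : ℝ => 1 / (2 * T) * ∫ t in (-T)..T, ‖P.eval (Complex.I * t)‖ ^ p) atTop
      (𝓝 (P.norm p ^ p)) := by
  refine ((P.tendsto_mean hp).rpow_const (p := p) (Or.inr hp.le)).congr' ?_
  filter_upwards [eventually_gt_atTop 0] with T hT
  have : 0 ≤ ∫ t in (-T)..T, ‖P.eval (Complex.I * t)‖ ^ p :=
    intervalIntegral.integral_nonneg (by linarith) fun t _ => by positivity
  rw [DirichletPoly.mean, ← Real.rpow_mul (by positivity), one_div_mul_cancel hp.ne', Real.rpow_one]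

/-- The `p`-th power of the `𝓗^p`-norm is estimated through the square of the modulus of a
trigonometric polynomial, whose mean is known exactly. -/
theorem DirichletPoly.norm_rpow_le_of_le {p : ℝ} (hp : 0 < p) (P : DirichletPoly) {ι : Type*}
    (S : Finset ι) {l : ι → ℝ} (hl : Function.Injective l) (b : ι → ℂ) {η : ℝ}
    (h : ∀ t : ℝ, ‖P.eval (Complex.I * t)‖ ^ p ≤
      ‖∑ i ∈ S, b i * Complex.exp (Complex.I * l i * t)‖ ^ 2 + η) :
    P.norm p ^ p ≤ ∑ i ∈ S, ‖b i‖ ^ 2 + η := by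
  refine le_of_tendsto_of_tendsto (P.tendsto_mean_rpow hp)
    ((tendsto_mean_norm_sq_sum_exp S hl b).add_const η) ?_
  filter_upwards [eventually_gt_atTop 0] with T hT
  have hc : Continuous fun t : ℝ => ‖∑ i ∈ S, b i * Complex.exp (Complex.I * l i * t)‖ ^ 2 := by
    fun_prop
  calc 1 / (2 * T) * ∫ t in (-T)..T, ‖P.eval (Complex.I * t)‖ ^ p
      ≤ 1 / (2 * T) * ∫ t in (-T)..T,
          (‖∑ i ∈ S, b i * Complex.exp (Complex.I * l i * t)‖ ^ 2 + η) := by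
        gcongr
        refine intervalIntegral.integral_mono_on (by linarith) ?_ ?_ fun t _ => h t
        · exact (P.continuous_eval.norm.rpow_const fun _ => Or.inr hp.le).intervalIntegrable _ _
        · exact (hc.add continuous_const).intervalIntegrable _ _
    _ = _ := by
        rw [intervalIntegral.integral_add (hc.intervalIntegrable _ _) intervalIntegrable_const,
          intervalIntegral.integral_const, mul_add, smul_eq_mul]
        congr 1
        field_simp
        ring

/-- The algebra of functions generated by the functions `s ↦ n ^ (-s)`. It consists of the functions
given by Dirichlet polynomials, see `exists_eval_eq_of_mem_dirichletPolyAlgebra`. -/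
noncomputable def dirichletPolyAlgebra : Subalgebra ℂ (ℂ → ℂ) :=
  Algebra.adjoin ℂ (Set.range fun (n : ℕ+) (s : ℂ) => ((n : ℕ) : ℂ) ^ (-s))

theorem exists_eval_eq_of_mem_dirichletPolyAlgebra {g : ℂ → ℂ} (hg : g ∈ dirichletPolyAlgebra) :
    ∃ P : DirichletPoly, ∀ s, P.eval s = g s := by
  let S : Submonoid (ℂ → ℂ) :=
    { carrier := Set.range fun (n : ℕ+) (s : ℂ) => ((n : ℕ) : ℂ) ^ (-s)
      one_mem' := ⟨1, by ext s; simp⟩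
      mul_mem' := by
        rintro _ _ ⟨a, rfl⟩ ⟨b, rfl⟩
        refine ⟨a * b, ?_⟩
        ext s
        simp [Complex.natCast_mul_natCast_cpow] }
  have h : g ∈ Subalgebra.toSubmodule dirichletPolyAlgebra := hg
  rw [dirichletPolyAlgebra, Algebra.adjoin_eq_span] at h
  have hS : Submonoid.closure (Set.range fun (n : ℕ+) (s : ℂ) => ((n : ℕ) : ℂ) ^ (-s)) = S :=
    Submonoid.closure_eq S
  rw [hS] at h
  obtain ⟨P, hP⟩ := (Finsupp.mem_span_range_iff_exists_finsupp
    (v := fun (n : ℕ+) (s : ℂ) => ((n : ℕ) : ℂ) ^ (-s))).mp h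
  refine ⟨P, fun s => ?_⟩
  rw [← hP, DirichletPoly.eval, Finsupp.sum, Finsupp.sum, Finset.sum_apply]
  rfl

/-- `g` is bounded on the closed right half-plane, and a uniform limit of Dirichlet polynomials
there. -/
def IsUniformDirichletLimit (g : ℂ → ℂ) : Prop :=
  (∃ B, ∀ s : ℂ, 0 ≤ s.re → ‖g s‖ ≤ B) ∧
    ∀ ε > 0, ∃ h ∈ dirichletPolyAlgebra, ∀ s : ℂ, 0 ≤ s.re → ‖h s - g s‖ ≤ ε

theorem IsUniformDirichletLimit.one : IsUniformDirichletLimit 1 :=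
  ⟨⟨1, fun s _ => by simp⟩, fun ε hε => ⟨1, one_mem _, fun s _ => by simpa using hε.le⟩⟩

theorem IsUniformDirichletLimit.mul {f g : ℂ → ℂ} (hf : IsUniformDirichletLimit f)
    (hg : IsUniformDirichletLimit g) : IsUniformDirichletLimit (f * g) := by
  obtain ⟨⟨B, hB⟩, hf⟩ := hf
  obtain ⟨⟨B', hB'⟩, hg⟩ := hg
  have hB0 : 0 ≤ B := (norm_nonneg _).trans (hB 0 le_rfl)
  have hB0' : 0 ≤ B' := (norm_nonneg _).trans (hB' 0 le_rfl)
  refine ⟨⟨B * B', fun s hs => ?_⟩, fun ε hε => ?_⟩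
  · rw [Pi.mul_apply, norm_mul]
    exact mul_le_mul (hB s hs) (hB' s hs) (norm_nonneg _) hB0
  · set K := B + B' + 1
    have hK : 0 < K := by positivity
    obtain ⟨u, hu, huf⟩ := hf (min 1 (ε / K)) (by positivity)
    obtain ⟨v, hv, hvg⟩ := hg (ε / K) (by positivity)
    refine ⟨u * v, mul_mem hu hv, fun s hs => ?_⟩
    have h1 := huf s hs
    have h2 := hvg s hs
    have h3 : ‖u s‖ ≤ B + 1 := by
      calc ‖u s‖ = ‖(u s - f s) + f s‖ := by ring_nf
        _ ≤ ‖u s - f s‖ + ‖f s‖ := norm_add_le _ _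
        _ ≤ B + 1 := by linarith [hB s hs, h1.trans (min_le_left _ _)]
    calc ‖(u * v) s - (f * g) s‖ = ‖u s * (v s - g s) + (u s - f s) * g s‖ := by
          simp only [Pi.mul_apply]
          ring_nf
      _ ≤ ‖u s‖ * ‖v s - g s‖ + ‖u s - f s‖ * ‖g s‖ := by
          refine (norm_add_le _ _).trans_eq ?_
          rw [norm_mul, norm_mul]
      _ ≤ (B + 1) * (ε / K) + (ε / K) * B' :=
          add_le_add (mul_le_mul h3 h2 (norm_nonneg _) (by positivity))
            (mul_le_mul (h1.trans (min_le_right _ _)) (hB' s hs) (norm_nonneg _) (by positivity))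
      _ = ε := by
          field_simp
          ring

/-- One factor of a power of the Euler product: the binomial series converges uniformly. -/
theorem isUniformDirichletLimit_one_add_cpow {x : ℂ → ℂ} (hx : x ∈ dirichletPolyAlgebra) {r : ℝ}
    (hr : r < 1) (hxr : ∀ s : ℂ, 0 ≤ s.re → ‖x s‖ ≤ r) (a : ℂ) :
    IsUniformDirichletLimit fun s => (1 + x s) ^ a := by
  have hr0 : 0 ≤ r := (norm_nonneg _).trans (hxr 0 le_rfl)
  obtain ⟨r', hr', hr1⟩ := exists_between hr
  have hball : ∀ s : ℂ, 0 ≤ s.re → x s ∈ Metric.ball (0 : ℂ) r' := fun s hs =>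
    mem_ball_zero_iff.mpr ((hxr s hs).trans_lt hr')
  constructor
  · have hc : ContinuousOn (fun z : ℂ => (1 + z) ^ a) (Metric.closedBall 0 r) := by
      intro z hz
      refine ContinuousAt.continuousWithinAt (ContinuousAt.cpow (by fun_prop) (by fun_prop) ?_)
      exact Complex.mem_slitPlane_of_norm_lt_one ((mem_closedBall_zero_iff.mp hz).trans_lt hr)
    obtain ⟨B, hB⟩ := (isCompact_closedBall (0 : ℂ) r).exists_bound_of_continuousOn hc
    exact ⟨B, fun s hs => hB _ (mem_closedBall_zero_iff.mpr (hxr s hs))⟩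
  · intro ε hε
    have hser := Complex.one_add_cpow_hasFPowerSeriesOnBall_zero (a := a)
    lift r' to NNReal using hr0.trans hr'.le
    have hunif := hser.tendstoUniformlyOn (r' := r') (by exact_mod_cast hr1)
    obtain ⟨n, hn⟩ := (Metric.tendstoUniformlyOn_iff.mp hunif ε hε).exists
    refine ⟨∑ k ∈ Finset.range n, (binomialSeries ℂ a).coeff k • x ^ k,
      sum_mem fun k _ => Subalgebra.smul_mem _ (pow_mem hx k) _, fun s hs => ?_⟩
    have h := hn (x s) (hball s hs)
    rw [dist_comm, dist_eq_norm, zero_add] at h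
    refine le_trans (le_of_eq ?_) h.le
    congr 2
    simp only [FormalMultilinearSeries.partialSum, Finset.sum_apply, Pi.smul_apply, Pi.pow_apply,
      FormalMultilinearSeries.apply_eq_pow_smul_coeff, smul_eq_mul, mul_comm]

/-! ### Powers of finite Euler products as test functions -/

/-- The finite Euler product `∏_{q < N} (1 - q^{-(s + a)})⁻¹`, as a function of `s`. -/
noncomputable def eulerProdBelow (a : ℂ) (N : ℕ) (s : ℂ) : ℂ :=
  ∏ q ∈ N.primesBelow, (1 - (q : ℂ) ^ (-(s + a)))⁻¹

theorem norm_natCast_cpow_neg_lt_one {q : ℕ} (hq : 1 < q) {z : ℂ} (hz : 0 < z.re) :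
    ‖(q : ℂ) ^ (-z)‖ < 1 := by
  rw [Complex.norm_natCast_cpow_of_pos (by omega), Complex.neg_re]
  exact Real.rpow_lt_one_of_one_lt_of_neg (by exact_mod_cast hq) (by linarith)

/-- The power `2 / p` of the modulus of a finite Euler product is the modulus of a uniform limit
of Dirichlet polynomials. -/
theorem exists_isUniformDirichletLimit_eulerProdBelow {a : ℂ} (ha : 0 < a.re) (N : ℕ) (κ : ℝ) :
    ∃ F : ℂ → ℂ, IsUniformDirichletLimit F ∧
      ∀ s : ℂ, ‖F s‖ = ‖eulerProdBelow a N s‖ ^ κ := by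
  refine ⟨∏ q ∈ N.primesBelow, fun s => (1 + -(q : ℂ) ^ (-(s + a))) ^ ((-κ : ℝ) : ℂ), ?_,
    fun s => ?_⟩
  · refine Finset.prod_induction _ IsUniformDirichletLimit (fun _ _ => .mul) .one fun q hq => ?_
    have hqp := Nat.prime_of_mem_primesBelow hq
    have hq0 : (q : ℂ) ≠ 0 := by exact_mod_cast hqp.ne_zero
    refine isUniformDirichletLimit_one_add_cpow (x := fun s => -(q : ℂ) ^ (-(s + a)))
      (r := ‖(q : ℂ) ^ (-a)‖) ?_ (norm_natCast_cpow_neg_lt_one hqp.one_lt ha) (fun s hs => ?_) _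
    · have h1 : (fun s : ℂ => (q : ℂ) ^ (-s)) ∈ dirichletPolyAlgebra :=
        Algebra.subset_adjoin ⟨⟨q, hqp.pos⟩, rfl⟩
      have h2 := Subalgebra.smul_mem _ h1 (-(q : ℂ) ^ (-a))
      convert! h2 using 1
      ext s
      rw [Pi.smul_apply, smul_eq_mul, neg_mul, ← Complex.cpow_add _ _ hq0]
      ring_nf
    · rw [norm_neg, Complex.norm_natCast_cpow_of_pos hqp.pos,
        Complex.norm_natCast_cpow_of_pos hqp.pos]
      refine Real.rpow_le_rpow_of_exponent_le (by exact_mod_cast hqp.one_lt.le) ?_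
      simp only [Complex.neg_re, Complex.add_re]
      linarith
  · rw [Finset.prod_apply, norm_prod, eulerProdBelow, norm_prod,
      ← Real.finsetProd_rpow _ _ fun _ _ => norm_nonneg _]
    refine Finset.prod_congr rfl fun q _ => ?_
    rw [Complex.norm_cpow_real, ← sub_eq_add_neg, norm_inv, Real.inv_rpow (norm_nonneg _),
      Real.rpow_neg (norm_nonneg _)]

/-- The finite Euler product is the sum of `n ^ (-(s + a))` over the `N`-smooth numbers `n`,
uniformly on the closed right half-plane. -/
theorem exists_finset_norm_eulerProdBelow_sub_le {a : ℂ} (ha : 0 < a.re) (N : ℕ) {ε : ℝ}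
    (hε : 0 < ε) : ∃ S : Finset N.smoothNumbers, ∀ s : ℂ, 0 ≤ s.re →
      ‖eulerProdBelow a N s - ∑ n ∈ S, ((n : ℕ) : ℂ) ^ (-(s + a))‖ ≤ ε := by
  have hne : ∀ z : ℂ, 0 < z.re → z ≠ 0 := fun z hz h => by simp [h] at hz
  have hEP : ∀ z : ℂ, 0 < z.re →
      Summable (fun n : N.smoothNumbers => ‖((n : ℕ) : ℂ) ^ (-z)‖) ∧
      HasSum (fun n : N.smoothNumbers => ((n : ℕ) : ℂ) ^ (-z))
        (∏ q ∈ N.primesBelow, (1 - (q : ℂ) ^ (-z))⁻¹) := fun z hz =>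
    EulerProduct.summable_and_hasSum_smoothNumbers_prod_primesBelow_geometric
      (f := (riemannZetaSummandHom (hne z hz) : ℕ →* ℂ))
      (fun {q} hq => norm_natCast_cpow_neg_lt_one hq.one_lt hz) N
  have hunif := tendstoUniformlyOn_tsum (s := {s : ℂ | 0 ≤ s.re})
    (f := fun (n : N.smoothNumbers) (s : ℂ) => ((n : ℕ) : ℂ) ^ (-(s + a))) (hEP a ha).1
    (fun n s hs => by
      have hn : 0 < (n : ℕ) := Nat.pos_of_ne_zero (Nat.ne_zero_of_mem_smoothNumbers n.2)
      rw [Complex.norm_natCast_cpow_of_pos hn, Complex.norm_natCast_cpow_of_pos hn]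
      refine Real.rpow_le_rpow_of_exponent_le (by exact_mod_cast hn) ?_
      have hs' : 0 ≤ s.re := hs
      simp only [Complex.neg_re, Complex.add_re]
      linarith)
  obtain ⟨S, hS⟩ := (Metric.tendstoUniformlyOn_iff.mp hunif ε hε).exists
  refine ⟨S, fun s hs => ?_⟩
  have h := hS s hs
  have hz : 0 < (s + a).re := by
    rw [Complex.add_re]
    linarith
  rw [(hEP _ hz).2.tsum_eq, dist_eq_norm] at h
  exact h.le

theorem exists_forall_rpow_le_rpow_add {p : ℝ} (hp : 0 < p) (B : ℝ) {η : ℝ} (hη : 0 < η) :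
    ∃ ε > 0, ∀ x y : ℝ, 0 ≤ x → 0 ≤ y → y ≤ B → x ≤ y + ε → x ^ p ≤ y ^ p + η := by
  have hu : UniformContinuousOn (fun x : ℝ => x ^ p) (Set.Icc 0 (B + 1)) :=
    isCompact_Icc.uniformContinuousOn_of_continuous
      (Real.continuous_rpow_const hp.le).continuousOn
  obtain ⟨ε, hε, h⟩ := Metric.uniformContinuousOn_iff.mp hu η hη
  refine ⟨min 1 (ε / 2), by positivity, fun x y hx hy hyB hxy => ?_⟩
  have h1 : x ≤ y + 1 := hxy.trans (by gcongr; exact min_le_left _ _)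
  have h2 : x ≤ y + ε / 2 := hxy.trans (by gcongr; exact min_le_right _ _)
  rcases le_total x y with hle | hle
  · linarith [Real.rpow_le_rpow hx hle hp.le]
  · have h3 := h x ⟨hx, by linarith⟩ y ⟨hy, by linarith⟩
      (by rw [Real.dist_eq, abs_of_nonneg (by linarith)]; linarith)
    rw [Real.dist_eq] at h3
    linarith [(abs_lt.mp h3).2]

theorem sum_norm_sq_le_riemannZeta {a : ℂ} (ha : 1 / 2 < a.re) (N : ℕ)
    (S : Finset N.smoothNumbers) :
    ∑ n ∈ S, ‖((n : ℕ) : ℂ) ^ (-a)‖ ^ 2 ≤ ‖riemannZeta ((2 * a.re : ℝ) : ℂ)‖ := by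
  have h1 : 1 < 2 * a.re := by linarith
  have hsum : Summable fun n : ℕ => 1 / (n : ℝ) ^ (2 * a.re) :=
    Real.summable_one_div_nat_rpow.mpr h1
  have hz : riemannZeta ((2 * a.re : ℝ) : ℂ) =
      ((∑' n : ℕ, 1 / (n : ℝ) ^ (2 * a.re) : ℝ) : ℂ) := by
    rw [zeta_eq_tsum_one_div_nat_cpow (by simpa using h1), Complex.ofReal_tsum]
    refine tsum_congr fun n => ?_
    rw [Complex.ofReal_div, Complex.ofReal_one, Complex.ofReal_cpow n.cast_nonneg,
      Complex.ofReal_natCast]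
  have h0 : ∀ n : ℕ, 0 ≤ 1 / (n : ℝ) ^ (2 * a.re) := fun n => by positivity
  rw [hz, Complex.norm_real, Real.norm_of_nonneg (tsum_nonneg h0)]
  calc ∑ n ∈ S, ‖((n : ℕ) : ℂ) ^ (-a)‖ ^ 2
      = ∑ n ∈ S.map (Function.Embedding.subtype _), 1 / (n : ℝ) ^ (2 * a.re) := by
        rw [Finset.sum_map]
        refine Finset.sum_congr rfl fun n _ => ?_
        have hn : 0 < (n : ℕ) := Nat.pos_of_ne_zero (Nat.ne_zero_of_mem_smoothNumbers n.2)
        rw [Complex.norm_natCast_cpow_of_pos hn, ← Real.rpow_natCast,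
          ← Real.rpow_mul (by positivity), Function.Embedding.subtype_apply, one_div,
          ← Real.rpow_neg (by positivity)]
        congr 1
        simp only [Complex.neg_re]
        push_cast
        ring
    _ ≤ _ := hsum.sum_le_tsum _ fun n _ => h0 n

/-- The test functions: Dirichlet polynomials whose modulus is close to the power `2 / p` of that
of a finite Euler product. Their norms are controlled by the mean square of the Euler product
itself. -/
theorem exists_dirichletPoly_close_eulerProdBelow {p : ℝ} (hp : 0 < p) {a : ℂ} (ha : 1 / 2 < a.re)
    (N : ℕ) {ε : ℝ} (hε : 0 < ε) :
    ∃ P : DirichletPoly, P.norm p ^ p ≤ ‖riemannZeta ((2 * a.re : ℝ) : ℂ)‖ + 1 ∧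
      ∀ s : ℂ, 0 ≤ s.re → |‖P.eval s‖ - ‖eulerProdBelow a N s‖ ^ (2 / p)| ≤ ε := by
  have ha0 : 0 < a.re := by linarith
  obtain ⟨F, ⟨⟨B, hB⟩, hF⟩, hFG⟩ := exists_isUniformDirichletLimit_eulerProdBelow ha0 N (2 / p)
  have hFp : ∀ s, ‖F s‖ ^ p = ‖eulerProdBelow a N s‖ ^ (2 : ℝ) := fun s => by
    rw [hFG, ← Real.rpow_mul (norm_nonneg _), div_mul_cancel₀ 2 hp.ne']
  obtain ⟨ε₁, hε₁, h₁⟩ := exists_forall_rpow_le_rpow_add hp B (η := 1 / 2) (by norm_num)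
  obtain ⟨h, hh, hhF⟩ := hF (min ε ε₁) (by positivity)
  obtain ⟨P, hP⟩ := exists_eval_eq_of_mem_dirichletPolyAlgebra hh
  have hclose : ∀ s : ℂ, 0 ≤ s.re → |‖P.eval s‖ - ‖F s‖| ≤ min ε ε₁ := fun s hs => by
    rw [hP]
    exact (abs_norm_sub_norm_le _ _).trans (hhF s hs)
  -- the Euler product is bounded by `B ^ (p / 2)`, hence its partial sums by `B ^ (p / 2) + 1`
  obtain ⟨ε₂, hε₂, h₂⟩ := exists_forall_rpow_le_rpow_add two_pos (B ^ (p / 2) + 1)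
    (η := 1 / 2) (by norm_num)
  obtain ⟨S, hS⟩ := exists_finset_norm_eulerProdBelow_sub_le ha0 N (ε := min 1 ε₂) (by positivity)
  refine ⟨P, ?_, fun s hs => ?_⟩
  · have hl : Function.Injective fun n : N.smoothNumbers => -Real.log (n : ℕ) := by
      intro m n hmn
      have hm : 0 < (m : ℕ) := Nat.pos_of_ne_zero (Nat.ne_zero_of_mem_smoothNumbers m.2)
      have hn : 0 < (n : ℕ) := Nat.pos_of_ne_zero (Nat.ne_zero_of_mem_smoothNumbers n.2)
      have := Real.log_injOn_pos (Set.mem_Ioi.mpr (by exact_mod_cast hm : (0 : ℝ) < (m : ℕ)))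
        (Set.mem_Ioi.mpr (by exact_mod_cast hn : (0 : ℝ) < (n : ℕ))) (neg_injective hmn)
      exact Subtype.ext (by exact_mod_cast this)
    refine (P.norm_rpow_le_of_le hp S hl (fun n => ((n : ℕ) : ℂ) ^ (-a)) (η := 1) fun t => ?_).trans
      (by gcongr; exact sum_norm_sq_le_riemannZeta ha N S)
    have hs : 0 ≤ (Complex.I * t).re := by simp
    have hsum : ∑ n ∈ S, ((n : ℕ) : ℂ) ^ (-a) *
        Complex.exp (Complex.I * ((-Real.log (n : ℕ) : ℝ) : ℂ) * t) =
        ∑ n ∈ S, ((n : ℕ) : ℂ) ^ (-(Complex.I * t + a)) := by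
      refine Finset.sum_congr rfl fun n _ => ?_
      have hn : ((n : ℕ) : ℂ) ≠ 0 := by exact_mod_cast Nat.ne_zero_of_mem_smoothNumbers n.2
      rw [neg_add_rev, Complex.cpow_add _ _ hn, Complex.cpow_def_of_ne_zero hn (-(Complex.I * t)),
        ← Complex.natCast_log]
      push_cast
      ring_nf
    rw [hsum]
    set Q := ∑ n ∈ S, ((n : ℕ) : ℂ) ^ (-(Complex.I * t + a))
    set G := eulerProdBelow a N (Complex.I * t)
    have hQ := hS (Complex.I * t) hs
    have hGB : ‖G‖ ≤ B ^ (p / 2) := by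
      have h3 : ‖G‖ = ‖F (Complex.I * t)‖ ^ (p / 2) := by
        rw [hFG, ← Real.rpow_mul (norm_nonneg _)]
        field_simp
        rw [Real.rpow_one]
      rw [h3]
      exact Real.rpow_le_rpow (norm_nonneg _) (hB _ hs) (by positivity)
    have hdiff := abs_le.mp ((abs_norm_sub_norm_le G Q).trans hQ)
    have hmin1 := min_le_left 1 ε₂
    have hmin2 := min_le_right 1 ε₂
    have h4 := h₂ ‖G‖ ‖Q‖ (norm_nonneg _) (norm_nonneg _) (by linarith [hdiff.1])
      (by linarith [hdiff.2])
    have h5 := h₁ ‖P.eval (Complex.I * t)‖ ‖F (Complex.I * t)‖ (norm_nonneg _) (norm_nonneg _)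
      (hB _ hs) (by linarith [(abs_le.mp (hclose _ hs)).2, min_le_right ε ε₁])
    rw [hFp] at h5
    rw [Real.rpow_two, Real.rpow_two] at h4
    rw [Real.rpow_two] at h5
    linarith
  · rw [← hFG]
    exact (hclose s hs).trans (min_le_left _ _)

/-- A Dirichlet polynomial is represented by a constant sequence, so its norm as an element of `𝓗^p`
is at most its norm as a Dirichlet polynomial. -/
theorem lintegral_le_of_isCarlesonDirichletHardy {p C : ℝ} (hp : 0 < p) (hC : 0 < C)
    {μ : Measure halfPlane}
    (hμ : ∀ F : ℂ → ℂ, MemDirichletHardy p F →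
      ∫⁻ s : halfPlane, ‖F s‖ₑ ^ p ∂μ ≤ ENNReal.ofReal (C * dirichletHardyNorm p F ^ p))
    (P : DirichletPoly) :
    ∫⁻ s : halfPlane, ‖P.eval s‖ₑ ^ p ∂μ ≤ ENNReal.ofReal (C * P.norm p ^ p) := by
  have hrep : DirichletPoly.Represents p (fun _ => P) P.eval := by
    refine ⟨fun ε hε => ⟨0, fun m _ n _ => ?_⟩, fun s _ => tendsto_const_nhds⟩
    have h0 : (0 : DirichletPoly).norm p = 0 := by
      have h1 := (0 : DirichletPoly).tendsto_mean hp
      refine tendsto_nhds_unique h1 ((tendsto_const_nhds (x := (0 : ℝ))).congr fun T => ?_)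
      simp [DirichletPoly.mean, DirichletPoly.eval, hp.ne']
    rw [sub_self, h0]
    exact hε
  refine (hμ P.eval ⟨_, hrep⟩).trans (ENNReal.ofReal_le_ofReal ?_)
  have hnonneg : ∀ M ∈ {M : ℝ | ∃ D : ℕ → DirichletPoly, DirichletPoly.Represents p D P.eval ∧
      Tendsto (fun k => (D k).norm p) atTop (𝓝 M)}, 0 ≤ M := by
    rintro M ⟨D, _, hD⟩
    exact ge_of_tendsto' hD fun k => (D k).norm_nonneg hp
  have hle : dirichletHardyNorm p P.eval ≤ P.norm p :=
    csInf_le ⟨0, hnonneg⟩ ⟨_, hrep, tendsto_const_nhds⟩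
  gcongr
  exact Real.sInf_nonneg hnonneg

/-! ### The box condition -/

theorem isClosed_carlesonBox (δ t : ℝ) : IsClosed (carlesonBox δ t) := by
  have h1 : Continuous fun s : halfPlane => (s : ℂ).re := by fun_prop
  have h2 : Continuous fun s : halfPlane => |(s : ℂ).im - t| := by fun_prop
  exact (isClosed_le h1 continuous_const).inter (isClosed_le h2 continuous_const)

theorem exists_riemannZeta_bounds_near_one :
    ∃ ρ > 0, ∀ z : ℂ, z ≠ 1 → ‖z - 1‖ < ρ →
      1 / 2 ≤ ‖z - 1‖ * ‖riemannZeta z‖ ∧ ‖z - 1‖ * ‖riemannZeta z‖ ≤ 2 := by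
  have h := riemannZeta_residue_one.norm.eventually
    (Icc_mem_nhds (a := 1 / 2) (b := 2) (by norm_num) (by norm_num))
  rw [eventually_nhdsWithin_iff, Metric.eventually_nhds_iff] at h
  obtain ⟨ρ, hρ, h⟩ := h
  refine ⟨ρ, hρ, fun z hz hzρ => ?_⟩
  rw [← norm_mul]
  exact h (by rwa [dist_eq_norm]) hz

/-- The box condition for small boxes, obtained by testing with powers of the zeta function. -/
theorem exists_measure_carlesonBox_le {p C : ℝ} (hp : 0 < p) (hC : 0 < C)
    {μ : Measure halfPlane}
    (hμ : ∀ P : DirichletPoly,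
      ∫⁻ s : halfPlane, ‖P.eval s‖ₑ ^ p ∂μ ≤ ENNReal.ofReal (C * P.norm p ^ p)) :
    ∃ δ₀ > 0, ∀ δ t, 0 < δ → δ ≤ δ₀ → μ (carlesonBox δ t) ≤ ENNReal.ofReal (72 * C * δ) := by
  obtain ⟨ρ, hρ, hζ⟩ := exists_riemannZeta_bounds_near_one
  refine ⟨min 1 (ρ / 4), by positivity, fun δ t hδ hδ₀ => ?_⟩
  have hδ1 : δ ≤ 1 := hδ₀.trans (min_le_left _ _)
  have hδρ : δ ≤ ρ / 4 := hδ₀.trans (min_le_right _ _)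
  set a : ℂ := ⟨1 / 2 + δ, -t⟩
  have hare : a.re = 1 / 2 + δ := rfl
  have haim : a.im = -t := rfl
  have ha : 1 / 2 < a.re := by rw [hare]; linarith
  have hnorm : ‖riemannZeta ((2 * a.re : ℝ) : ℂ)‖ + 1 ≤ 2 / δ := by
    have e : ((2 * a.re : ℝ) : ℂ) - 1 = ((2 * δ : ℝ) : ℂ) := by
      rw [hare]
      push_cast
      ring
    have e' : ‖((2 * a.re : ℝ) : ℂ) - 1‖ = 2 * δ := by
      rw [e, Complex.norm_real, Real.norm_of_nonneg (by positivity)]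
    have h1 := (hζ ((2 * a.re : ℝ) : ℂ) (fun h => by
      rw [h, sub_self, norm_zero] at e'
      linarith) (by rw [e']; linarith)).2
    rw [e'] at h1
    rw [le_div_iff₀ hδ]
    nlinarith
  have hP : ∀ N : ℕ, ∃ P : DirichletPoly, P.norm p ^ p ≤ 2 / δ ∧ ∀ s : ℂ, 0 ≤ s.re →
      |‖P.eval s‖ - ‖eulerProdBelow a N s‖ ^ (2 / p)| ≤ 1 / ((N : ℝ) + 1) := fun N => by
    obtain ⟨P, h1, h2⟩ := exists_dirichletPoly_close_eulerProdBelow hp ha N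
      (ε := 1 / ((N : ℝ) + 1)) (by positivity)
    exact ⟨P, h1.trans hnorm, h2⟩
  choose P hPnorm hPclose using hP
  have hlim : ∀ s : halfPlane, Tendsto (fun N => ‖(P N).eval s‖ₑ ^ p) atTop
      (𝓝 (ENNReal.ofReal (‖riemannZeta (s + a)‖ ^ (2 : ℝ)))) := by
    intro s
    have hs : 1 / 2 < (s : ℂ).re := s.2
    have h1 : Tendsto (fun N => ‖eulerProdBelow a N s‖ ^ (2 / p)) atTop
        (𝓝 (‖riemannZeta (s + a)‖ ^ (2 / p))) :=
      ((riemannZeta_eulerProduct (s := s + a) (by rw [Complex.add_re]; linarith)).norm).rpow_const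
        (Or.inr (by positivity))
    have h2 : Tendsto (fun N => ‖(P N).eval s‖ - ‖eulerProdBelow a N s‖ ^ (2 / p)) atTop (𝓝 0) :=
      squeeze_zero_norm (fun N => hPclose N s (by linarith)) tendsto_one_div_add_atTop_nhds_zero_nat
    have h3 : Tendsto (fun N => ‖(P N).eval s‖) atTop (𝓝 (‖riemannZeta (s + a)‖ ^ (2 / p))) := by
      simpa using h2.add h1
    have h4 := h3.rpow_const (p := p) (Or.inr hp.le)
    rw [← Real.rpow_mul (norm_nonneg _), div_mul_cancel₀ 2 hp.ne'] at h4
    refine (ENNReal.tendsto_ofReal h4).congr fun N => ?_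
    rw [← ofReal_norm, ENNReal.ofReal_rpow_of_nonneg (norm_nonneg _) hp.le]
  have hbox : ∀ s ∈ carlesonBox δ t,
      ENNReal.ofReal ((1 / (6 * δ)) ^ (2 : ℝ)) ≤
        ENNReal.ofReal (‖riemannZeta (s + a)‖ ^ (2 : ℝ)) := by
    rintro s ⟨hs1, hs2⟩
    have hs : 1 / 2 < (s : ℂ).re := s.2
    refine ENNReal.ofReal_le_ofReal (Real.rpow_le_rpow (by positivity) ?_ zero_le_two)
    have hre : ((s : ℂ) + a - 1).re = (s : ℂ).re - 1 / 2 + δ := by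
      rw [Complex.sub_re, Complex.add_re, hare, Complex.one_re]
      ring
    have him : ((s : ℂ) + a - 1).im = (s : ℂ).im - t := by
      rw [Complex.sub_im, Complex.add_im, haim, Complex.one_im]
      ring
    have h3 : ‖(s : ℂ) + a - 1‖ ≤ 3 * δ := by
      refine (Complex.norm_le_abs_re_add_abs_im _).trans ?_
      rw [hre, him, abs_of_pos (by linarith)]
      linarith
    have hne : (s : ℂ) + a ≠ 1 := fun h => by
      rw [h, sub_self, Complex.zero_re] at hre
      linarith
    have h4 := (hζ _ hne (by linarith)).1
    rw [div_le_iff₀ (by positivity)]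
    nlinarith [norm_nonneg (riemannZeta (s + a))]
  have hmeas : ∀ N, Measurable fun s : halfPlane => ‖(P N).eval s‖ₑ ^ p := fun N => by
    refine Measurable.pow_const (Measurable.enorm ?_) _
    simp only [DirichletPoly.eval, Finsupp.sum]
    fun_prop
  have hK : ENNReal.ofReal ((1 / (6 * δ)) ^ (2 : ℝ)) * μ (carlesonBox δ t) ≤
      ENNReal.ofReal (C * (2 / δ)) := by
    calc ENNReal.ofReal ((1 / (6 * δ)) ^ (2 : ℝ)) * μ (carlesonBox δ t)
        = ∫⁻ s in carlesonBox δ t, ENNReal.ofReal ((1 / (6 * δ)) ^ (2 : ℝ)) ∂μ :=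
          (setLIntegral_const _ _).symm
      _ ≤ ∫⁻ s in carlesonBox δ t, liminf (fun N => ‖(P N).eval s‖ₑ ^ p) atTop ∂μ :=
          setLIntegral_mono' (isClosed_carlesonBox δ t).measurableSet fun s hs => by
            rw [(hlim s).liminf_eq]
            exact hbox s hs
      _ ≤ ∫⁻ s, liminf (fun N => ‖(P N).eval s‖ₑ ^ p) atTop ∂μ := setLIntegral_le_lintegral _ _
      _ ≤ liminf (fun N => ∫⁻ s, ‖(P N).eval s‖ₑ ^ p ∂μ) atTop := lintegral_liminf_le hmeas
      _ ≤ ENNReal.ofReal (C * (2 / δ)) := by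
          refine liminf_le_of_le (by isBoundedDefault) fun b hb => ?_
          obtain ⟨N, hN⟩ := hb.exists
          refine hN.trans ((hμ (P N)).trans (ENNReal.ofReal_le_ofReal ?_))
          exact mul_le_mul_of_nonneg_left (hPnorm N) hC.le
  have h0 : 0 < (1 / (6 * δ)) ^ (2 : ℝ) := by positivity
  rw [mul_comm, ← ENNReal.le_div_iff_mul_le (Or.inl (ENNReal.ofReal_pos.mpr h0).ne')
    (Or.inl ENNReal.ofReal_ne_top), ← ENNReal.ofReal_div_of_pos h0] at hK
  refine hK.trans_eq ?_
  congr 1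
  rw [Real.rpow_two]
  field_simp
  norm_num

theorem theorem3 (p : ℝ) (hp : 1 ≤ p) (μ : MeasureTheory.Measure halfPlane)
    (hμ : IsCarlesonDirichletHardy p μ) : IsCarlesonHardy p μ := by
  have hp0 : 0 < p := by linarith
  obtain ⟨C, hC, hμ⟩ := hμ
  have hpoly := lintegral_le_of_isCarlesonDirichletHardy hp0 hC hμ
  obtain ⟨δ₀, hδ₀, hsmall⟩ := exists_measure_carlesonBox_le hp0 hC hpoly
  -- testing with the constant function `1` shows that `μ` is finite
  let one : DirichletPoly := Finsupp.single 1 1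
  set V := C * one.norm p ^ p
  have hV0 : 0 ≤ V := by
    have := one.norm_nonneg hp0
    positivity
  have hV : μ Set.univ ≤ ENNReal.ofReal V := by
    refine le_trans (le_of_eq ?_) (hpoly one)
    simp [one, DirichletPoly.eval]
  refine isCarlesonHardy_of_carlesonBox hp0 (A := 72 * C + V / δ₀) (by positivity)
    fun δ t hδ => ?_
  rw [← ENNReal.ofReal_mul (by positivity)]
  rcases le_total δ δ₀ with h | h
  · refine (hsmall δ t hδ h).trans (ENNReal.ofReal_le_ofReal ?_)
    gcongr
    exact le_add_of_nonneg_right (by positivity)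
  · refine (measure_mono (Set.subset_univ _)).trans (hV.trans (ENNReal.ofReal_le_ofReal ?_))
    calc V = V / δ₀ * δ₀ := by field_simp
      _ ≤ (72 * C + V / δ₀) * δ := by
        gcongr
        exact le_add_of_nonneg_left (by positivity)
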